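/- All graphs are finite undirected pseudographs: loops and parallel edges are allowed, and a loop contributes $2$ to the degree of its vertex. A $(4,1)$-coloring of a $5$-regular graph is an edge-coloring, with any number of colors, such that at each vertex four of the five edge ends have one color and the remaining edge end has a different color (a loop contributes two ends, both of its color). A $5$-regular graph $G$ without a $(4,1)$-coloring is called vertex-minimal if every $5$-regular graph with fewer vertices than $G$ has a $(4,1)$-coloring. **Theorem 3.3.** Let $G$ be a vertex-minimal $5$-regular graph without a $(4,1)$-coloring. Then: (a) $G$ does not contain a $4$-regular subgraph (not necessarily induced or connected) with at least $2$ vertices. (b) $G$ does not have $3$ parallel edges, i.e. no three distinct edges of $G$ have the same ends. (c) $G$ does not contain a path of length three consisting of double edges, i.e. there are no four distinct vertices $p_0,p_1,p_2,p_3$ such that $p_{i}$ and $p_{i+1}$ are joined by at least two edges for each $i\in\{0,1,2\}$. (d) No vertex of $G$ that has a loop is incident to a double edge, i.e. is joined to another vertex by at least two edges. (e) No two distinct vertices with loops are adjacent. (f) $G$ contains at least $5$ loops. (g) There do not exist distinct vertices $u_1,u_2,u_3,v_1,v_2,v_3$ of $G$ such that each $u_i$ has a loop and, for all $i,j\in\{1,2,3\}$,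 $u_i$ is adjacent to $v_j$. (h) No vertex of $G$ is adjacent to more than $3$ other vertices with loops. (i) No subgraph of $G$ with exactly $4$ vertices has $8$ or more edges (each loop counting as one edge). -/

import Mathlib

open scoped Graph

namespace Graph

universe u v

/-- A pseudograph is a `Graph α β` (loops and parallel edges allowed); it is finite when it has
finitely many vertices and finitely many edges. -/
structure IsFinite {α : Type u} {β : Type v} (G : Graph α β) : Prop where
  vertexSet_finite : V(G).Finite
  edgeSet_finite : E(G).Finite

/-- The number of ends at `x` of edges of `G` lying in `F`: every edge of `F` incident to `x` is
counted once, and every loop of `F` at `x` is counted once more (so twice in total). -/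
noncomputable def degreeIn {α : Type u} {β : Type v} (G : Graph α β) (F : Set β) (x : α) : ℕ :=
  {e | e ∈ F ∧ G.Inc e x}.ncard + {e | e ∈ F ∧ G.IsLoopAt e x}.ncard

/-- The degree of a vertex, loops being counted twice. -/
noncomputable def degree {α : Type u} {β : Type v} (G : Graph α β) (x : α) : ℕ :=
  G.degreeIn E(G) x

/-- Every vertex of `G` has degree `r`. -/
def IsRegular {α : Type u} {β : Type v} (G : Graph α β) (r : ℕ) : Prop :=
  ∀ x ∈ V(G), G.degree x = r

/-- `c` is an `(a, b)`-coloring: at every vertex there are `a` edge ends of one color and `b` edge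
ends of a different color. In an `(a + b)`-regular graph these are all the edge ends at the vertex;
if `a`, `b` are positive and there is a vertex, then at least two colors occur. Only the values of
`c` on the edges of `G` matter. -/
def IsEdgeColoring {α : Type u} {β : Type v} (G : Graph α β) (a b : ℕ) (c : β → ℕ) : Prop :=
  ∀ x ∈ V(G), ∃ i j : ℕ, i ≠ j ∧
    G.degreeIn {e | c e = i} x = a ∧ G.degreeIn {e | c e = j} x = b

/-- `G` has an `(a, b)`-coloring. For a finite graph it is no restriction that the colors are
natural numbers. -/
def HasEdgeColoring {α : Type u} {β : Type v} (G : Graph α β) (a b : ℕ) : Prop :=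
  ∃ c : β → ℕ, G.IsEdgeColoring a b c

/-- `G` is a vertex-minimal `5`-regular graph without a `(4, 1)`-coloring: it is one, and every
finite `5`-regular graph with fewer vertices has a `(4, 1)`-coloring. -/
structure IsVertexMinimalUncolorable {α : Type u} {β : Type v} (G : Graph α β) : Prop where
  finite : G.IsFinite
  regular : G.IsRegular 5
  not_hasEdgeColoring : ¬ G.HasEdgeColoring 4 1
  minimal : ∀ (α' : Type u) (β' : Type v) (G' : Graph α' β'), G'.IsFinite → G'.IsRegular 5 →
    V(G').ncard < V(G).ncard → G'.HasEdgeColoring 4 1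

/-- The vertex `x` has a loop. -/
def HasLoop {α : Type u} {β : Type v} (G : Graph α β) (x : α) : Prop :=
  ∃ e, G.IsLoopAt e x

/-- The number of edges with ends `x` and `y`. -/
noncomputable def multiplicity {α : Type u} {β : Type v} (G : Graph α β) (x y : α) : ℕ :=
  {e | G.IsLink e x y}.ncard

/-- `x` and `y` are adjacent distinct vertices. -/
def Neighbor {α : Type u} {β : Type v} (G : Graph α β) (x y : α) : Prop :=
  x ≠ y ∧ G.Adj x y

/-- `x` and `y` are distinct vertices joined by (at least) two parallel edges. -/
def DoubleEdge {α : Type u} {β : Type v} (G : Graph α β) (x y : α) : Prop :=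
  x ≠ y ∧ 2 ≤ G.multiplicity x y

end Graph

/-!
A finite pseudograph is treated as a map `a : ι × Bool → V`, which attaches the two halves of every
edge to vertices; a `(4, 1)`-coloring colors the edges so that at every vertex all half-edges but
one have the same color (`HalfEdge.GoodAt`).

The basic reduction is `ColorableBelow.exists_coloring`. Suppose that all `5`-regular pseudographs
with fewer than `n` vertices can be colored. Then a pseudograph with fewer than `n` vertices of odd
degree, these degrees being at most `5`, has an edge-coloring which is good at the vertices of odd
degree and constant at each vertex of degree `2`: at a vertex of even degree two half-edges can be
merged, which splices their edges, and at a vertex of degree `1` or `3` loops can be added.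

In a minimal uncolorable graph one deletes a set `W` of vertices and attaches the half-edges left
dangling to new vertices, fewer than `|W|` of which have odd degree. The coloring of the rest must
not extend to `W`. Two versions of this are used.

* All of `W` becomes one vertex (`IsMinimal.exists_coloring_contract`). This excludes `4`-regular
  subgraphs, whose edges could get a new color.
* The dangling half-edges are divided into pairs, which get equal colors, and a few single ones
  (`IsMinimal.not_gadget`). If every such coloring extends to `W`, then the configuration on `W`
  cannot occur. This excludes multiple edges and loops that are too close to each other.

A path of three double edges needs an additional recoloring at the ends of the path
(`IsMinimal.not_double_path`). A multigraph on four vertices with eight edges which contains none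
of the configurations above is one of seven (`hasForbidden_of_card_eq_eight`), and each of these is
excluded by a pairing of its four dangling half-edges.

The number of loops is bounded by means of Tutte's theorem. A perfect matching would be a color
class of a coloring, so there is a set `S` of vertices whose removal leaves at least `|S| + 2` odd
components. The number of edges leaving an odd component is odd. If it is one, then the component
has at least two loops (`IsMinimal.two_le_card_loops`), and if it is three, then the component has
at least one loop (`IsMinimal.one_le_card_loops`). As at most `5 |S|` edges leave the components,
there are at least five loops.
-/

open scoped Graph

namespace HalfEdge

open Finset

universe u

/-! ### Even and small vertices can be colored by merging half-edges -/

/-- The half-edges attached to `x` by `a : H → V` are colored by `c` with one color `i`, except for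
exactly one half-edge, which has another color. For five half-edges this is the condition that
a `(4, 1)`-coloring has to satisfy at `x`. -/
def GoodAt {V H κ : Type*} (a : H → V) (c : H → κ) (x : V) : Prop :=
  ∃ i h₀, a h₀ = x ∧ c h₀ ≠ i ∧ ∀ h, a h = x → h ≠ h₀ → c h = i

/-- The number of half-edges attached to `x`. A finite pseudograph with edge set `ι` is given by a
map `a : ι × Bool → V`; both half-edges of a loop are attached to the same vertex, so that a loop
counts twice. -/
def deg {V H : Type*} [Fintype H] [DecidableEq V] (a : H → V) (x : V) : ℕ :=
  #{h | a h = x}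

section GoodAt

variable {V V' H H' κ κ' : Type*}

lemma GoodAt.comp_injective {a : H → V} {c : H → κ} {x : V} (hg : GoodAt a c x) {f : κ → κ'}
    (hf : f.Injective) : GoodAt a (fun h => f (c h)) x := by
  obtain ⟨i, h₀, h1, h2, h3⟩ := hg
  exact ⟨f i, h₀, h1, hf.ne h2, fun h ha hne => congrArg f (h3 h ha hne)⟩

lemma GoodAt.congr {a : H → V} {c c' : H → κ} {x : V} (hg : GoodAt a c x)
    (hc : ∀ h, a h = x → c' h = c h) : GoodAt a c' x := by
  obtain ⟨i, h₀, h1, h2, h3⟩ := hg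
  exact ⟨i, h₀, h1, by rwa [hc _ h1], fun h ha hne => by rw [hc h ha, h3 h ha hne]⟩

/-- Goodness is transported along a color-preserving map `e` from the half-edges at `x'` to
those at `x` that is onto. -/
lemma GoodAt.map {a : H → V} {c : H → κ} {x : V} {a' : H' → V'} {c' : H' → κ} {x' : V'}
    (e : H' → H) (hx : ∀ h', a (e h') = x ↔ a' h' = x')
    (hs : ∀ h, a h = x → ∃ h', e h' = h) (hc : ∀ h', a' h' = x' → c (e h') = c' h')
    (hg : GoodAt a' c' x') : GoodAt a c x := by
  obtain ⟨i, h₀, h1, h2, h3⟩ := hg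
  refine ⟨i, e h₀, (hx _).2 h1, by rwa [hc _ h1], fun h ha hne => ?_⟩
  obtain ⟨h', rfl⟩ := hs h ha
  have := (hx _).1 ha
  rw [hc _ this]
  exact h3 h' this fun h => hne (by rw [h])

end GoodAt

section Merge

variable {V H H' : Type*} {ι : Type u} [DecidableEq V] [Fintype H] [Fintype H']

lemma deg_comp_of_injective {V' : Type*} [DecidableEq V'] {a : H → V} {a' : H' → V'} {x : V}
    {x' : V'} (e : H' → H) (he : e.Injective) (hx : ∀ h', a (e h') = x ↔ a' h' = x')
    (hs : ∀ h, a h = x → ∃ h', e h' = h) : deg a' x' = deg a x := by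
  unfold deg
  refine card_bij (fun h _ => e h) (fun h hh => ?_) (fun _ _ _ _ h => he h) fun h hh => ?_
  · simpa [hx] using hh
  · obtain ⟨h', rfl⟩ := hs h (by simpa using hh)
    exact ⟨h', by simpa [hx] using hh, rfl⟩

/-- Every `5`-regular pseudograph with fewer than `n` vertices has a `(4, 1)`-coloring. -/
def ColorableBelow (n : ℕ) : Prop :=
  ∀ (N M : ℕ) (b : Fin M × Bool → Fin N), N < n → (∀ x, deg b x = 5) →
    ∃ c : Fin M → ℕ, ∀ x, GoodAt b (fun h => c h.1) x

variable [Fintype ι]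

lemma ColorableBelow.exists_coloring_regular [Fintype V] {n : ℕ} (hn : ColorableBelow n)
    (a : ι × Bool → V)
    (hV : Fintype.card V < n) (ha : ∀ x, deg a x = 5) :
    ∃ c : ι → ℕ, ∀ x, GoodAt a (fun h => c h.1) x := by
  let eV := Fintype.equivFin V
  let eι := Fintype.equivFin ι
  let e : ι × Bool → Fin (Fintype.card ι) × Bool := fun h => (eι h.1, h.2)
  have he : e.Injective := fun h h' hh => by
    simp only [e, Prod.mk.injEq, EmbeddingLike.apply_eq_iff_eq] at hh
    exact Prod.ext hh.1 hh.2
  have hs : ∀ h, ∃ h', e h' = h := fun h => ⟨(eι.symm h.1, h.2), by simp [e]⟩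
  let b : Fin (Fintype.card ι) × Bool → Fin (Fintype.card V) :=
    fun h => eV (a (eι.symm h.1, h.2))
  have hb : ∀ h x, b (e h) = x ↔ a h = eV.symm x := fun h x => by
    simp [b, e, Equiv.eq_symm_apply]
  obtain ⟨c, hc⟩ := hn _ _ b hV fun x => by
    rw [← ha (eV.symm x)]
    exact (deg_comp_of_injective e he (fun h => hb h x) fun h _ => hs h).symm
  refine ⟨fun i => c (eι i), fun x => ?_⟩
  refine GoodAt.map (fun h => (eι.symm h.1, h.2)) (fun h => ?_) (fun h _ => ?_)
    (fun h _ => ?_) (hc (eV x))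
  · simp [b]
  · exact ⟨e h, by simp [e]⟩
  · simp

/-- Loops can be added at the vertices of degree `1` and `3`. -/
lemma ColorableBelow.exists_coloring_of_odd {n : ℕ} [Fintype V] (hn : ColorableBelow n)
    (a : ι × Bool → V)
    (hV : Fintype.card V < n) (ha : ∀ x, Odd (deg a x)) (h5 : ∀ x, deg a x ≤ 5) :
    ∃ c : ι → ℕ, ∀ x, GoodAt a (fun h => c h.1) x := by
  classical
  obtain ⟨k, hk⟩ : ∃ k : V → ℕ, ∀ x, deg a x + 2 * k x = 5 := by
    refine ⟨fun x => (5 - deg a x) / 2, fun x => ?_⟩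
    dsimp only
    have := h5 x
    obtain ⟨m, hm⟩ := ha x
    omega
  let b : (ι ⊕ (Σ x : V, Fin (k x))) × Bool → V :=
    fun h => h.1.elim (fun i => a (i, h.2)) fun l => l.1
  have hdeg : ∀ x, deg b x = 5 := by
    intro x
    let f₁ : ι × Bool → (ι ⊕ (Σ x : V, Fin (k x))) × Bool := fun h => (Sum.inl h.1, h.2)
    let f₂ : Fin (k x) × Bool → (ι ⊕ (Σ x : V, Fin (k x))) × Bool :=
      fun h => (Sum.inr ⟨x, h.1⟩, h.2)
    have hf₁ : f₁.Injective := fun h h' hh => by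
      simp only [f₁, Prod.mk.injEq, Sum.inl.injEq] at hh
      exact Prod.ext hh.1 hh.2
    have hf₂ : f₂.Injective := fun h h' hh => by
      simp only [f₂, Prod.mk.injEq, Sum.inr.injEq, Sigma.mk.injEq, heq_eq_eq, true_and] at hh
      exact Prod.ext hh.1 hh.2
    have h1 : (univ.filter fun h => b h = x) =
        (univ.filter fun h => a h = x).image f₁ ∪ univ.image f₂ := by
      ext ⟨i | ⟨y, l⟩, t⟩
      · simp [b, f₁, f₂]
      · simp only [mem_filter, mem_univ, true_and, mem_union, mem_image, b, f₁, f₂, Sum.elim_inr,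
          Prod.mk.injEq, reduceCtorEq, false_and, and_false, exists_false, false_or,
          Sum.inr.injEq, Sigma.mk.injEq]
        constructor
        · rintro rfl
          exact ⟨(l, t), by simp⟩
        · rintro ⟨_, ⟨h, _⟩, _⟩
          exact h.symm
    rw [← hk x]
    unfold deg
    rw [h1, card_union_of_disjoint, card_image_of_injective _ hf₁, card_image_of_injective _ hf₂,
      card_univ, Fintype.card_prod, Fintype.card_fin, Fintype.card_bool, mul_comm]
    rw [disjoint_left]
    simp [f₁, f₂]
  obtain ⟨c, hc⟩ := hn.exists_coloring_regular b hV hdeg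
  refine ⟨fun i => c (Sum.inl i), fun x => ?_⟩
  obtain ⟨i, ⟨e | l, t⟩, h1, h2, h3⟩ := hc x
  · exact ⟨i, (e, t), h1, h2, fun h ha hne => h3 (Sum.inl h.1, h.2) ha fun hh => hne <| by
      simp only [Prod.mk.injEq, Sum.inl.injEq] at hh; exact Prod.ext hh.1 hh.2⟩
  · -- the two half-edges of a loop have the same color, so neither of them is the exceptional one
    exact absurd (h3 (Sum.inr l, !t) h1 (by simp)) h2

/-- Removing two half-edges `h₁` and `h₂` at `x` lowers the degree of `x` by two and keeps the other
degrees; the remaining half-edges are parametrized by `e`. -/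
lemma deg_of_merge {a : H → V} {h₁ h₂ : H} {x : V} (h12 : h₁ ≠ h₂)
    (h1 : a h₁ = x) (h2 : a h₂ = x) (e : H' → H) (he : e.Injective)
    (hr : ∀ h, (∃ h', e h' = h) ↔ h ≠ h₁ ∧ h ≠ h₂) :
    deg a x = deg (a ∘ e) x + 2 ∧ ∀ y, y ≠ x → deg a y = deg (a ∘ e) y := by
  classical
  constructor
  · unfold deg
    have : (univ.filter fun h => a h = x) =
        insert h₁ (insert h₂ ((univ.filter fun h' => (a ∘ e) h' = x).map ⟨e, he⟩)) := by
      ext h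
      simp only [mem_filter, mem_univ, true_and, mem_insert, mem_map, Function.comp,
        Function.Embedding.coeFn_mk]
      constructor
      · intro hh
        by_cases g1 : h = h₁
        · exact .inl g1
        by_cases g2 : h = h₂
        · exact .inr (.inl g2)
        obtain ⟨h', rfl⟩ := (hr h).2 ⟨g1, g2⟩
        exact .inr (.inr ⟨h', hh, rfl⟩)
      · rintro (rfl | rfl | ⟨h', hh, rfl⟩)
        exacts [h1, h2, hh]
    have g1 : ∀ h', e h' ≠ h₁ := fun h' => ((hr _).1 ⟨h', rfl⟩).1
    have g2 : ∀ h', e h' ≠ h₂ := fun h' => ((hr _).1 ⟨h', rfl⟩).2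
    rw [this, card_insert_of_notMem, card_insert_of_notMem, card_map]
    · simp [g2]
    · simp [h12, g1]
  · intro y hy
    refine (deg_comp_of_injective e he (fun _ => Iff.rfl) fun h hh => (hr h).2 ⟨?_, ?_⟩).symm
    · rintro rfl; exact hy (hh.symm.trans h1)
    · rintro rfl; exact hy (hh.symm.trans h2)

/-- Merging two half-edges `h₁` and `h₂`: a loop formed by them is deleted, and otherwise their
edges are spliced. The map `e` embeds the half-edges of the new pseudograph into the old ones, and
`f` turns a coloring of the new edges into one of the old edges. -/
lemma exists_merge {ι : Type u} [Fintype ι] {h₁ h₂ : ι × Bool} (h12 : h₁ ≠ h₂) :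
    ∃ (ι' : Type u) (_ : Fintype ι') (e : ι' × Bool → ι × Bool) (f : (ι' → ℕ) → ι → ℕ),
      Fintype.card ι' < Fintype.card ι ∧ e.Injective ∧
      (∀ h, (∃ h', e h' = h) ↔ h ≠ h₁ ∧ h ≠ h₂) ∧ (∀ c h, f c (e h).1 = c h.1) ∧
      ∀ c, f c h₁.1 = f c h₂.1 := by
  classical
  obtain ⟨i₁, t₁⟩ := h₁
  obtain ⟨i₂, t₂⟩ := h₂
  by_cases hedge : i₁ = i₂
  · subst hedge
    have ht : ∀ t, t = t₁ ∨ t = t₂ := by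
      have : t₁ ≠ t₂ := fun h => h12 (by rw [h])
      intro t
      cases t <;> cases t₁ <;> cases t₂ <;> simp_all
    refine ⟨{i // i ≠ i₁}, inferInstance, fun h => (h.1.1, h.2),
      fun c i => if hi : i ≠ i₁ then c ⟨i, hi⟩ else 0,
      Fintype.card_subtype_lt (x := i₁) (by simp), ?_, ?_, ?_, fun c => rfl⟩
    · intro h h' hh
      simp only [Prod.mk.injEq] at hh
      exact Prod.ext (Subtype.ext hh.1) hh.2
    · rintro ⟨i, t⟩
      constructor
      · rintro ⟨⟨⟨j, hj⟩, s⟩, hh⟩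
        cases hh
        simp [hj]
      · rintro ⟨g1, g2⟩
        have hi : i ≠ i₁ := by
          rintro rfl
          rcases ht t with rfl | rfl
          exacts [g1 rfl, g2 rfl]
        exact ⟨(⟨i, hi⟩, t), rfl⟩
    · rintro c ⟨⟨i, hi⟩, t⟩
      simp [hi]
  · refine ⟨{i // i ≠ i₂}, inferInstance,
      fun h => if h.1.1 = i₁ ∧ h.2 = t₁ then (i₂, !t₂) else (h.1.1, h.2),
      fun c i => if hi : i ≠ i₂ then c ⟨i, hi⟩ else c ⟨i₁, hedge⟩,
      Fintype.card_subtype_lt (x := i₂) (by simp), ?_, ?_, ?_, ?_⟩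
    · rintro ⟨⟨i, hi⟩, t⟩ ⟨⟨i', hi'⟩, t'⟩ hh
      simp only at hh
      split_ifs at hh with g g'
      · obtain ⟨rfl, rfl⟩ := g
        obtain ⟨rfl, rfl⟩ := g'
        rfl
      · exact absurd (congrArg Prod.fst hh).symm hi'
      · exact absurd (congrArg Prod.fst hh) hi
      · cases hh
        rfl
    · rintro ⟨i, t⟩
      constructor
      · rintro ⟨⟨⟨j, hj⟩, s⟩, hh⟩
        simp only at hh
        split_ifs at hh with h
        · cases hh
          exact ⟨fun h => hedge (congrArg Prod.fst h).symm, fun h => by simp at h⟩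
        · cases hh
          exact ⟨fun h' => h ⟨congrArg Prod.fst h', congrArg Prod.snd h'⟩,
            fun h' => hj (congrArg Prod.fst h')⟩
      · rintro ⟨g1, g2⟩
        by_cases hi : i = i₂
        · subst hi
          refine ⟨(⟨i₁, hedge⟩, t₁), ?_⟩
          have : t ≠ t₂ := fun h => g2 (by rw [h])
          cases t <;> cases t₂ <;> simp_all
        · refine ⟨(⟨i, hi⟩, t), if_neg ?_⟩
          rintro ⟨rfl, rfl⟩
          exact g1 rfl
    · rintro c ⟨⟨i, hi⟩, t⟩
      by_cases g : i = i₁ ∧ t = t₁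
      · obtain ⟨rfl, rfl⟩ := g
        simp
      · simp [g, hi]
    · intro c
      simp [hedge]

/-- The reduction that everything else rests on. Vertices of even degree are dissolved by repeatedly
merging two of their half-edges, and the vertices of odd degree are those of a smaller `5`-regular
pseudograph. -/
theorem ColorableBelow.exists_coloring {n : ℕ} [Fintype V] (hn : ColorableBelow n)
    (a : ι × Bool → V)
    (h5 : ∀ x, Odd (deg a x) → deg a x ≤ 5) (hodd : #{x | Odd (deg a x)} < n) :
    ∃ c : ι → ℕ, (∀ x, Odd (deg a x) → GoodAt a (fun h => c h.1) x) ∧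
      ∀ x, deg a x = 2 → ∀ h h', a h = x → a h' = x → c h.1 = c h'.1 := by
  classical
  induction hm : Fintype.card ι using Nat.strong_induction_on generalizing ι with
  | _ m ih =>
  subst hm
  by_cases hall : ∀ h, Odd (deg a (a h))
  · -- all edges join vertices of odd degree
    obtain ⟨c, hc⟩ := hn.exists_coloring_of_odd (V := {x // Odd (deg a x)})
      (fun h => ⟨a h, hall h⟩) (by rwa [Fintype.card_subtype])
      (fun x => by
        rw [deg_comp_of_injective (a := a) (x := x.1) id Function.injective_id
          (fun h => by simp [Subtype.ext_iff]) fun h _ => ⟨h, rfl⟩]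
        exact x.2)
      (fun x => by
        rw [deg_comp_of_injective (a := a) (x := x.1) id Function.injective_id
          (fun h => by simp [Subtype.ext_iff]) fun h _ => ⟨h, rfl⟩]
        exact h5 _ x.2)
    refine ⟨c, fun x hx => (hc ⟨x, hx⟩).map id
      (fun h => by simp [Subtype.ext_iff]) (fun h _ => ⟨h, rfl⟩) fun _ _ => rfl, ?_⟩
    rintro x hx h h' rfl -
    have := hall h
    rw [hx] at this
    exact absurd this (by decide)
  push Not at hall
  obtain ⟨h₁, hx⟩ := hall
  obtain ⟨x, h1⟩ : ∃ x, a h₁ = x := ⟨_, rfl⟩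
  rw [h1] at hx
  have hx' : 1 < deg a x := by
    have : 0 < deg a x := card_pos.2 ⟨h₁, by simp [h1]⟩
    rcases Nat.lt_or_ge 1 (deg a x) with h | h
    · exact h
    · have : deg a x = 1 := by omega
      rw [this] at hx
      exact absurd (by decide) hx
  obtain ⟨h₂, hh₂, h12⟩ := exists_mem_ne hx' h₁
  have h2 : a h₂ = x := by simpa using hh₂
  -- it suffices to color the pseudograph in which `h₁` and `h₂` are merged
  suffices key : ∃ (ι' : Type u) (_ : Fintype ι') (e : ι' × Bool → ι × Bool) (f : (ι' → ℕ) → ι → ℕ),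
      Fintype.card ι' < Fintype.card ι ∧ e.Injective ∧
      (∀ h, (∃ h', e h' = h) ↔ h ≠ h₁ ∧ h ≠ h₂) ∧ (∀ c h, f c (e h).1 = c h.1) ∧
      ∀ c, f c h₁.1 = f c h₂.1 by
    obtain ⟨ι', _, e, f, hcard, he, hr, hf, hf12⟩ := key
    obtain ⟨dx, dy⟩ := deg_of_merge h12.symm h1 h2 e he hr
    have hpar : ∀ y, Odd (deg (a ∘ e) y) ↔ Odd (deg a y) := by
      intro y
      by_cases hy : y = x
      · subst hy; rw [dx]; simp [Nat.odd_add]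
      · rw [dy y hy]
    obtain ⟨c, hc1, hc2⟩ := ih _ hcard (a ∘ e)
      (fun y hy => by
        have := h5 y ((hpar y).1 hy)
        by_cases hy' : y = x
        · subst hy'; omega
        · rwa [← dy y hy'])
      (by simpa only [hpar] using hodd) rfl
    have hs : ∀ y, y ≠ x → ∀ h, a h = y → ∃ h', e h' = h := by
      rintro y hy h rfl
      refine (hr h).2 ⟨?_, ?_⟩
      · rintro rfl; exact hy h1
      · rintro rfl; exact hy h2
    refine ⟨f c, fun y hy => ?_, fun y hy h h' hh hh' => ?_⟩
    · have hyx : y ≠ x := by rintro rfl; exact hx hy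
      exact (hc1 y ((hpar y).2 hy)).map e (fun _ => Iff.rfl) (hs y hyx) fun h _ => hf c h
    · by_cases hyx : y = x
      · subst hyx
        have h0 : deg (a ∘ e) y = 0 := by omega
        have key : ∀ h, a h = y → f c h.1 = f c h₁.1 := by
          intro h hh
          by_cases g1 : h = h₁
          · rw [g1]
          by_cases g2 : h = h₂
          · rw [g2, hf12]
          obtain ⟨h', rfl⟩ := (hr h).2 ⟨g1, g2⟩
          have : 0 < deg (a ∘ e) y := card_pos.2 ⟨h', by simpa using hh⟩
          omega
        rw [key h hh, key h' hh']
      · obtain ⟨k, rfl⟩ := hs y hyx h hh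
        obtain ⟨k', rfl⟩ := hs y hyx h' hh'
        rw [hf, hf]
        exact hc2 y (by rw [← dy y hyx, hy]) k k' hh hh'
  exact exists_merge h12.symm

end Merge

/-! ### Reducible configurations -/

/-- The half-edge form of a vertex-minimal `5`-regular pseudograph without a `(4, 1)`-coloring. -/
structure IsMinimal {V ι : Type*} [Fintype V] [DecidableEq V] [Fintype ι] (a : ι × Bool → V) :
    Prop where
  deg_eq : ∀ x, deg a x = 5
  not_colorable : ¬ ∃ c : ι → ℕ, ∀ x, GoodAt a (fun h => c h.1) x
  colorableBelow : ColorableBelow (Fintype.card V)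

section Reduction

variable {V Γ : Type*} {ι : Type u} [DecidableEq V] [Fintype ι] {a : ι × Bool → V}

lemma exists_notMem_range [Finite Γ] (c : Γ → ℕ) : ∃ n, ∀ j, c j ≠ n := by
  obtain ⟨n, hn⟩ := (Set.finite_range c).exists_notMem
  exact ⟨n, fun j hj => hn ⟨j, hj⟩⟩

/-- The number of half-edges at a set of vertices of a `5`-regular pseudograph. -/
lemma card_filter_mem (ha : ∀ x, deg a x = 5) (C : Finset V) : #{h | a h ∈ C} = 5 * #C := by
  rw [card_eq_sum_card_fiberwise (f := a) (t := C) (fun h hh => by simpa using hh),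
    sum_const_nat (m := 5), mul_comm]
  intro x hx
  rw [← ha x, deg, filter_filter]
  congr 1
  ext h
  simp only [mem_filter, mem_univ, true_and, and_iff_right_iff_imp]
  rintro rfl
  exact hx

variable [DecidableEq ι]

/-- The half-edges at vertices of `W` whose edges are not in `F`. -/
def outs (a : ι × Bool → V) (W : Finset V) (F : Finset ι) : Finset (ι × Bool) :=
  {h | a h ∈ W ∧ h.1 ∉ F}

lemma mem_outs {W : Finset V} {F : Finset ι} {h : ι × Bool} :
    h ∈ outs a W F ↔ a h ∈ W ∧ h.1 ∉ F := by
  simp [outs]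

variable [Fintype V] [Fintype Γ] [DecidableEq Γ]

/-- Delete a set `W` of vertices and a set `F` of edges with ends in `W` only, and attach the
remaining half-edges at `W` to new vertices, as prescribed by `g`. If the new pseudograph has fewer
vertices of odd degree than the old one, then it can be colored. -/
theorem IsMinimal.exists_coloring_off (hG : IsMinimal a) (W : Finset V) (F : Finset ι)
    (hF : ∀ h : ι × Bool, h.1 ∈ F → a h ∈ W) (g : ι × Bool → Γ)
    (h5 : ∀ j, Odd #{h ∈ outs a W F | g h = j} → #{h ∈ outs a W F | g h = j} ≤ 5)
    (hodd : #{j | Odd #{h ∈ outs a W F | g h = j}} < #W) :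
    ∃ c : ι → ℕ, (∀ x, x ∉ W → GoodAt a (fun h => c h.1) x) ∧
      (∀ j, Odd #{h ∈ outs a W F | g h = j} → ∃ i, ∃ h₀ ∈ outs a W F, g h₀ = j ∧ c h₀.1 ≠ i ∧
        ∀ h ∈ outs a W F, g h = j → h ≠ h₀ → c h.1 = i) ∧
      ∀ j, #{h ∈ outs a W F | g h = j} = 2 →
        ∀ h ∈ outs a W F, ∀ h' ∈ outs a W F, g h = j → g h' = j → c h.1 = c h'.1 := by
  let b : ι × Bool → V ⊕ Option Γ := fun h =>
    if h.1 ∈ F then .inr none else if a h ∈ W then .inr (some (g h)) else .inl (a h)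
  have hb1 : ∀ h x, b h = .inl x ↔ a h = x ∧ x ∉ W := by
    intro h x
    simp only [b]
    split_ifs with h1 h2
    · simpa using fun hx => hx ▸ hF h h1
    · simpa using fun hx => hx ▸ h2
    · simp only [Sum.inl.injEq, iff_self_and]
      exact fun hx => hx ▸ h2
  have hb2 : ∀ h j, b h = .inr (some j) ↔ h ∈ outs a W F ∧ g h = j := by
    intro h j
    simp only [b, mem_outs]
    split_ifs with h1 h2
    · simp [h1]
    · simp [h1, h2]
    · simp [h2]
  have hd1 : ∀ x, x ∉ W → deg b (.inl x) = 5 := fun x hx => by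
    rw [← hG.deg_eq x, deg, deg]
    simp [hb1, hx]
  have hd2 : ∀ x, x ∈ W → deg b (.inl x) = 0 := fun x hx => by
    rw [deg]
    simp [hb1, hx]
  have hd3 : ∀ j, deg b (.inr (some j)) = #{h ∈ outs a W F | g h = j} := fun j => by
    rw [deg]
    congr 1
    ext h
    simp [hb2]
  have hd4 : deg b (.inr none) = #F * 2 := by
    rw [deg, ← Fintype.card_bool, ← card_univ, ← card_product]
    congr 1
    ext h
    simp only [mem_filter, mem_univ, true_and, b, mem_product, and_true]
    split_ifs with h1 h2 <;> simp [h1]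
  have ho : ∀ y : V ⊕ Option Γ, Odd (deg b y) ↔
      y ∈ (Wᶜ).map .inl ∪ (univ.filter fun j => Odd #{h ∈ outs a W F | g h = j}).map
        (Function.Embedding.some.trans .inr) := by
    rintro (x | _ | j)
    · by_cases hx : x ∈ W
      · simp [hd2 x hx, hx]
      · simp only [hd1 x hx, mem_union, mem_map, mem_compl, Function.Embedding.inl_apply,
          Sum.inl.injEq, exists_eq_right, hx, not_false_eq_true, true_or, iff_true]
        decide
    · rw [hd4]
      simp
    · simp [hd3]
  obtain ⟨c, hc1, hc2⟩ := hG.colorableBelow.exists_coloring b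
    (by
      rintro (x | _ | j) hy
      · by_cases hx : x ∈ W
        · simp [hd2 x hx]
        · simp [hd1 x hx]
      · rw [hd4, Nat.odd_mul] at hy
        exact absurd hy.2 (by decide)
      · rw [hd3] at hy ⊢
        exact h5 j hy)
    (by
      simp only [ho, filter_mem_eq_inter, univ_inter]
      refine (card_union_le _ _).trans_lt ?_
      rw [card_map, card_map, card_compl]
      have := card_le_univ W
      omega)
  refine ⟨c, fun x hx => ?_, fun j hj => ?_, fun j hj h hh h' hh' hg hg' => ?_⟩
  · exact (hc1 (.inl x) (by rw [hd1 x hx]; decide)).map id (fun h => by simp [hb1, hx])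
      (fun h _ => ⟨h, rfl⟩) fun _ _ => rfl
  · obtain ⟨i, h₀, g1, g2, g3⟩ := hc1 (.inr (some j)) (by rwa [hd3])
    rw [hb2] at g1
    exact ⟨i, h₀, g1.1, g1.2, g2, fun h hh hg hne => g3 h ((hb2 _ _).2 ⟨hh, hg⟩) hne⟩
  · exact hc2 (.inr (some j)) (by rw [hd3, hj]) h h' ((hb2 _ _).2 ⟨hh, hg⟩) ((hb2 _ _).2 ⟨hh', hg'⟩)

/-- Contract a set `C` of at least two vertices to one vertex, which keeps the half-edges in `X`.
The remaining half-edges at `C`, whose number is even, are attached to another new vertex. -/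
theorem IsMinimal.exists_coloring_contract (hG : IsMinimal a) (C : Finset V) (hC : 2 ≤ #C)
    (X : Finset (ι × Bool)) (hXC : ∀ h ∈ X, a h ∈ C) (hX : #X ≤ 5) (hpar : Even #X ↔ Even #C) :
    ∃ c : ι → ℕ, (∀ x, x ∉ C → GoodAt a (fun h => c h.1) x) ∧
      (Odd #X → ∃ i, ∃ h₀ ∈ X, c h₀.1 ≠ i ∧ ∀ h ∈ X, h ≠ h₀ → c h.1 = i) := by
  have e1 : {h ∈ outs a C ∅ | decide (h ∈ X) = true} = X := by
    ext h
    simpa [mem_outs] using hXC h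
  have e2 : #X + #{h ∈ outs a C ∅ | decide (h ∈ X) = false} = 5 * #C := by
    rw [← card_filter_mem hG.deg_eq, ← card_union_of_disjoint]
    · congr 1
      ext h
      simp only [mem_union, mem_filter, mem_outs, notMem_empty, not_false_eq_true, and_true,
        decide_eq_false_iff_not, mem_univ, true_and]
      have := hXC h
      tauto
    · rw [disjoint_left]
      intro h hh
      simp [hh]
  have e3 : ¬ Odd #{h ∈ outs a C ∅ | decide (h ∈ X) = false} := by
    rw [Nat.not_odd_iff_even]
    have h1 : Even (#X + #{h ∈ outs a C ∅ | decide (h ∈ X) = false}) ↔ Even (5 * #C) := by rw [e2]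
    rw [Nat.even_add, Nat.even_mul] at h1
    have : ¬ Even 5 := by decide
    tauto
  obtain ⟨c, hc1, hc2, -⟩ := hG.exists_coloring_off C ∅ (by simp) (fun h => decide (h ∈ X))
    (by
      rintro (_ | _) hj
      · exact absurd hj e3
      · rwa [e1])
    (by
      refine lt_of_le_of_lt (card_le_card (t := {true}) fun j hj => ?_) (by rwa [card_singleton])
      cases j
      · exact absurd (by simpa using hj) e3
      · simp)
  refine ⟨c, hc1, fun hodd => ?_⟩
  obtain ⟨i, h₀, g1, g2, g3, g4⟩ := hc2 true (by rwa [e1])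
  exact ⟨i, h₀, by simpa using g2, g3, fun h hh hne =>
    g4 h (by simpa [mem_outs] using hXC h hh) (by simpa using hh) hne⟩

/-- There is no `4`-regular subgraph, with vertex set `C` and edge set `F`, on at least two
vertices: its edges could be given a new color. -/
theorem IsMinimal.not_four_regular (hG : IsMinimal a) (C : Finset V) (F : Finset ι) (hC : 2 ≤ #C)
    (hF : ∀ h : ι × Bool, h.1 ∈ F → a h ∈ C) (h4 : ∀ x ∈ C, #{h | a h = x ∧ h.1 ∈ F} = 4) :
    False := by
  obtain ⟨c, hc⟩ : ∃ c : ι → ℕ, ∀ x, x ∉ C → GoodAt a (fun h => c h.1) x := by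
    by_cases hpar : Even #C
    · obtain ⟨c, hc, -⟩ := hG.exists_coloring_contract C hC ∅ (by simp) (by simp) (by simpa)
      exact ⟨c, hc⟩
    · obtain ⟨x, hx⟩ := card_pos.1 (by omega : 0 < #C)
      obtain ⟨h, hh⟩ := card_pos.1 (by rw [h4 x hx]; simp : 0 < #{h | a h = x ∧ h.1 ∈ F})
      obtain ⟨c, hc, -⟩ := hG.exists_coloring_contract C hC {h}
        (by
          simp only [mem_singleton, forall_eq]
          rw [(mem_filter.1 hh).2.1]
          exact hx)
        (by simp) (by simpa using hpar)
      exact ⟨c, hc⟩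
  obtain ⟨n, hn⟩ := exists_notMem_range c
  refine hG.not_colorable ⟨fun i => if i ∈ F then n else c i, fun x => ?_⟩
  by_cases hx : x ∈ C
  · have h1 : #{h | a h = x ∧ h.1 ∉ F} = 1 := by
      have h2 := hG.deg_eq x
      rw [deg, ← card_filter_add_card_filter_not (fun h => h.1 ∈ F), filter_filter, filter_filter,
        h4 x hx] at h2
      omega
    obtain ⟨h₀, hh₀⟩ := card_eq_one.1 h1
    have h3 : ∀ h, a h = x ∧ h.1 ∉ F ↔ h = h₀ := fun h => by
      simpa using congrArg (h ∈ ·) hh₀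
    obtain ⟨h4, h5⟩ := (h3 h₀).2 rfl
    refine ⟨n, h₀, h4, by simpa [h5] using hn h₀.1, fun h hh hne => ?_⟩
    by_cases h6 : h.1 ∈ F
    · simp [h6]
    · exact absurd ((h3 h).1 ⟨hh, h6⟩) hne
  · exact (hc x hx).congr fun h hh => if_neg fun h6 => hx (hh ▸ hF h h6)

end Reduction

section Gadget

variable {V A B Z K M Q Γ : Type*} {ι : Type u}

lemma exists_injective_of_card_fiber_le [Fintype A] [Fintype B] [DecidableEq Z] (f : A → Z)
    (g : B → Z) (h : ∀ x, #{y | f y = f x} ≤ #{y | g y = f x}) :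
    ∃ φ : A → B, φ.Injective ∧ ∀ x, g (φ x) = f x := by
  have h' : ∀ z, Nonempty ({x // f x = z} ↪ {y // g y = z}) := by
    intro z
    apply Function.Embedding.nonempty_of_card_le
    rw [Fintype.card_subtype, Fintype.card_subtype]
    by_cases hz : ∃ x, f x = z
    · obtain ⟨x, rfl⟩ := hz
      exact h x
    · rw [card_eq_zero.2]
      · exact Nat.zero_le _
      · simpa [filter_eq_empty_iff] using hz
  have φ : ∀ z, {x // f x = z} ↪ {y // g y = z} := fun z => (h' z).some
  refine ⟨fun x => φ (f x) ⟨x, rfl⟩, fun x y hxy => ?_, fun x => (φ (f x) ⟨x, rfl⟩).2⟩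
  have h1 : f x = f y := by
    rw [← (φ (f x) ⟨x, rfl⟩).2, ← (φ (f y) ⟨y, rfl⟩).2]
    exact congrArg g hxy
  have h2 : ∀ (z) (hz : f y = z), (φ z ⟨y, hz⟩ : B) = φ (f y) ⟨y, rfl⟩ := by
    rintro _ rfl
    rfl
  have h3 : φ (f x) ⟨x, rfl⟩ = φ (f x) ⟨y, h1.symm⟩ := Subtype.ext (hxy.trans (h2 _ _).symm)
  simpa using (φ (f x)).injective h3

variable [Fintype V] [DecidableEq V] [Fintype ι] [DecidableEq ι] {a : ι × Bool → V}
  [Fintype K] [DecidableEq K] [Fintype M] [Fintype Q]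
  [Fintype Γ] [DecidableEq Γ]

/-- A gadget consists of vertices `K`, edges `M` with ends `en`, and dangling half-edges `Q`
attached by `out`, such that every vertex has degree `5`. It does not occur in a minimal pseudograph
if the dangling half-edges can be divided into pairs, and fewer than `|K|` single ones, such that
every coloring of the dangling half-edges that is constant on the pairs extends to the gadget. -/
theorem IsMinimal.not_gadget (hG : IsMinimal a) (en : M × Bool → K) (out : Q → K)
    (hdeg : ∀ k, #{h | en h = k} + #{q | out q = k} = 5) (grp : Q → Γ)
    (hgrp : ∀ j, #{q | grp q = j} = 2 ∨ #{q | grp q = j} = 1)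
    (hodd : #{j | #{q | grp q = j} = 1} < Fintype.card K)
    (hcol : ∀ γ : Γ → ℕ, ∃ f : M → ℕ, ∀ k,
      GoodAt (Sum.elim en out) (Sum.elim (fun h => f h.1) fun q => γ (grp q)) k)
    (w : K → V) (hw : w.Injective) (e : M → ι) (he : e.Injective)
    (hends : ∀ m, s(a (e m, false), a (e m, true)) = s(w (en (m, false)), w (en (m, true)))) :
    False := by
  -- `eh` maps the half-edges of the gadget to those of its copy
  obtain ⟨eh, heh1, heh2, heh3, heh4⟩ : ∃ eh : M × Bool → ι × Bool, (∀ h, (eh h).1 = e h.1) ∧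
      (∀ h, a (eh h) = w (en h)) ∧ eh.Injective ∧ ∀ m t, ∃ h, eh h = (e m, t) := by
    have : ∀ m, ∃ r : Bool, ∀ t, a (e m, xor r t) = w (en (m, t)) := by
      intro m
      rcases Sym2.eq_iff.1 (hends m) with h | h
      · exact ⟨false, fun t => by cases t; exacts [h.1, h.2]⟩
      · exact ⟨true, fun t => by cases t; exacts [h.2, h.1]⟩
    choose r hr using this
    refine ⟨fun h => (e h.1, xor (r h.1) h.2), fun _ => rfl, fun h => hr _ _, ?_, fun m t => ?_⟩
    · rintro ⟨m, t⟩ ⟨m', t'⟩ hh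
      simp only [Prod.mk.injEq] at hh
      obtain ⟨h1, h2⟩ := hh
      obtain rfl := he h1
      simpa using h2
    · exact ⟨(m, xor (r m) t), by simp⟩
  set W : Finset V := univ.image w with hW
  set F : Finset ι := univ.image e with hF
  have hWF : ∀ h : ι × Bool, h.1 ∈ F → a h ∈ W := by
    rintro ⟨i, t⟩ hi
    obtain ⟨m, -, rfl⟩ := mem_image.1 hi
    obtain ⟨h, hh⟩ := heh4 m t
    rw [← hh, heh2]
    exact mem_image_of_mem _ (mem_univ _)
  have hcnt : ∀ k, #{q | out q = k} = #{h : outs a W F | a h = w k} := by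
    intro k
    have h1 := hG.deg_eq (w k)
    rw [← hdeg k, deg, ← card_filter_add_card_filter_not (fun h => h.1 ∈ F), filter_filter,
      filter_filter] at h1
    have h2 : #{h | a h = w k ∧ h.1 ∈ F} = #{h | en h = k} := by
      symm
      refine card_bij (fun h _ => eh h) (fun h hh => ?_) (fun _ _ _ _ h => heh3 h) fun h hh => ?_
      · simp only [mem_filter, mem_univ, true_and] at hh ⊢
        rw [heh2, hh, heh1]
        exact ⟨rfl, mem_image_of_mem _ (mem_univ _)⟩
      · obtain ⟨i, t⟩ := h
        simp only [mem_filter, mem_univ, true_and, hF, mem_image] at hh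
        obtain ⟨h3, m, rfl⟩ := hh
        obtain ⟨h, hh⟩ := heh4 m t
        rw [← hh, heh2] at h3
        exact ⟨h, by simpa using hw h3, hh⟩
    have h3 : #{h | a h = w k ∧ h.1 ∉ F} = #{h : outs a W F | a h = w k} := by
      symm
      refine card_bij (fun h _ => h.1) (fun h hh => ?_) (fun _ _ _ _ h => Subtype.ext h)
        fun h hh => ?_
      · simpa [(mem_outs.1 h.2).2] using hh
      · simp only [mem_filter, mem_univ, true_and] at hh
        exact ⟨⟨h, mem_outs.2 ⟨by rw [hh.1]; exact mem_image_of_mem _ (mem_univ _), hh.2⟩⟩,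
          by simpa using hh.1, rfl⟩
    omega
  have hfib : ∀ q, #{p | w (out p) = w (out q)} = #{h : outs a W F | a h = w (out q)} := by
    intro q
    rw [← hcnt]
    simp [hw.eq_iff]
  obtain ⟨φ, hφ1, hφ2⟩ := exists_injective_of_card_fiber_le (fun q => w (out q))
    (fun h : outs a W F => a h) fun q => (hfib q).le
  have hφ3 : φ.Surjective := by
    intro h
    have h1 := (mem_outs.1 h.2).1
    obtain ⟨k, -, hk⟩ := mem_image.1 h1
    have h2 : (univ.filter fun q => out q = k).image φ =
        univ.filter fun h : outs a W F => a h = w k := by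
      apply eq_of_subset_of_card_le
      · intro h hh
        obtain ⟨q, hq, rfl⟩ := mem_image.1 hh
        simp only [mem_filter, mem_univ, true_and] at hq ⊢
        rw [hφ2, hq]
      · rw [← hcnt, card_image_of_injective _ hφ1]
    have h3 : h ∈ univ.filter fun h : outs a W F => a h = w k := by simp [hk]
    rw [← h2] at h3
    obtain ⟨q, -, hq⟩ := mem_image.1 h3
    exact ⟨q, hq⟩
  have hψ : Function.Injective fun q => (φ q : ι × Bool) := Subtype.val_injective.comp hφ1
  -- the group of a dangling half-edge; other half-edges get a junk value
  let g : ι × Bool → Option Γ :=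
    Function.extend (fun q => (φ q : ι × Bool)) (fun q => some (grp q)) fun _ => none
  have hg : ∀ q, g (φ q) = some (grp q) := fun q => hψ.extend_apply _ _ q
  have hR : ∀ j, {h ∈ outs a W F | g h = some j} =
      (univ.filter fun q => grp q = j).image fun q => (φ q : ι × Bool) := by
    intro j
    ext h
    simp only [mem_filter, mem_image, mem_univ, true_and]
    constructor
    · rintro ⟨h1, h2⟩
      obtain ⟨q, hq⟩ := hφ3 ⟨h, h1⟩
      obtain rfl : (φ q : ι × Bool) = h := congrArg Subtype.val hq
      rw [hg] at h2
      exact ⟨q, by simpa using h2, rfl⟩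
    · rintro ⟨q, rfl, rfl⟩
      exact ⟨(φ q).2, hg q⟩
  have hR' : ∀ j, #{h ∈ outs a W F | g h = some j} = #{q | grp q = j} := fun j => by
    rw [hR, card_image_of_injective _ hψ]
  have hR0 : #{h ∈ outs a W F | g h = none} = 0 := by
    rw [card_eq_zero, filter_eq_empty_iff]
    intro h hh h2
    obtain ⟨q, hq⟩ := hφ3 ⟨h, hh⟩
    obtain rfl : (φ q : ι × Bool) = h := congrArg Subtype.val hq
    rw [hg] at h2
    cases h2
  obtain ⟨c, hc1, -, hc2⟩ := hG.exists_coloring_off W F hWF g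
    (by
      rintro (_ | j) hj
      · omega
      · rw [hR']
        have := hgrp j
        omega)
    (by
      rw [hW, card_image_of_injective _ hw, card_univ]
      refine lt_of_le_of_lt ?_ hodd
      rw [← card_map (s := {j | #{q | grp q = j} = 1}) Function.Embedding.some]
      apply card_le_card
      rintro (_ | j) hj
      · rw [mem_filter, hR0] at hj
        exact absurd hj.2 (by decide)
      · rw [mem_filter, hR'] at hj
        refine mem_map_of_mem _ (mem_filter.2 ⟨mem_univ _, (hgrp j).resolve_left fun h => ?_⟩)
        rw [h] at hj
        exact absurd hj.2 (by decide))
  have hγ : ∀ j, ∃ n, ∀ q, grp q = j → c (φ q : ι × Bool).1 = n := by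
    intro j
    rcases hgrp j with h | h
    · obtain ⟨q₀, hq₀⟩ := card_pos.1 (by omega : 0 < #{q | grp q = j})
      refine ⟨c (φ q₀ : ι × Bool).1, fun q hq => ?_⟩
      refine hc2 (some j) (by rw [hR', h]) _ (φ q).2 _ (φ q₀).2 ?_ ?_
      · rw [hg, hq]
      · rw [hg, (mem_filter.1 hq₀).2]
    · obtain ⟨q₀, hq₀⟩ := card_eq_one.1 h
      refine ⟨c (φ q₀ : ι × Bool).1, fun q hq => ?_⟩
      have : q ∈ ({q₀} : Finset Q) := hq₀ ▸ mem_filter.2 ⟨mem_univ _, hq⟩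
      rw [mem_singleton.1 this]
  choose γ hγ using hγ
  obtain ⟨f, hf⟩ := hcol γ
  refine hG.not_colorable ⟨Function.extend e f c, fun x => ?_⟩
  have hout : ∀ i, i ∉ F → Function.extend e f c i = c i := fun i hi =>
    Function.extend_apply' _ _ _ fun ⟨m, hm⟩ => hi (hm ▸ mem_image_of_mem _ (mem_univ _))
  by_cases hx : x ∈ W
  · obtain ⟨k, -, rfl⟩ := mem_image.1 hx
    refine (hf k).map (Sum.elim eh fun q => (φ q : ι × Bool)) ?_ ?_ ?_
    · rintro (h | q)
      · simp [heh2, hw.eq_iff]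
      · simp [hφ2, hw.eq_iff]
    · rintro ⟨i, t⟩ hh
      by_cases hi : i ∈ F
      · obtain ⟨m, -, rfl⟩ := mem_image.1 hi
        obtain ⟨h, hh⟩ := heh4 m t
        exact ⟨.inl h, hh⟩
      · obtain ⟨q, hq⟩ := hφ3 ⟨(i, t), mem_outs.2 ⟨by rwa [hh], hi⟩⟩
        exact ⟨.inr q, congrArg Subtype.val hq⟩
    · rintro (h | q) -
      · simp [heh1, he.extend_apply]
      · simp only [Sum.elim_inr]
        rw [hout _ (mem_outs.1 (φ q).2).2]
        exact hγ _ q rfl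
  · refine (hc1 x hx).congr fun h hh => hout _ fun hi => hx (hh ▸ hWF h hi)

end Gadget

/-! ### Multiple edges, loops and their neighbors -/

/-- The number of edges with ends `x` and `y`. -/
def mult {V ι : Type*} [Fintype ι] [DecidableEq V] (a : ι × Bool → V) (x y : V) : ℕ :=
  #{e | s(a (e, false), a (e, true)) = s(x, y)}

lemma mult_comm {V ι : Type*} [Fintype ι] [DecidableEq V] (a : ι × Bool → V) (x y : V) :
    mult a x y = mult a y x := by
  rw [mult, mult, Sym2.eq_swap]

instance {V H κ : Type*} [DecidableEq V] [Fintype H] [DecidableEq H] [Fintype κ] [DecidableEq κ]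
    (a : H → V) (c : H → κ) (x : V) : Decidable (GoodAt a c x) :=
  inferInstanceAs (Decidable (∃ i h₀, a h₀ = x ∧ c h₀ ≠ i ∧ ∀ h, a h = x → h ≠ h₀ → c h = i))

section

variable {V K M Q Γ : Type*} {ι : Type u} [Fintype V] [DecidableEq V] [Fintype ι] [DecidableEq ι]
  {a : ι × Bool → V}

/-- A form of `IsMinimal.not_gadget` in which the edges of the gadget are given by their numbers. -/
theorem IsMinimal.not_gadget_of_mult [Fintype K] [DecidableEq K] [Fintype M] [Fintype Q]
    [Fintype Γ] [DecidableEq Γ] (hG : IsMinimal a) (en : M × Bool → K) (out : Q → K)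
    (hdeg : ∀ k, #{h | en h = k} + #{q | out q = k} = 5) (grp : Q → Γ)
    (hgrp : ∀ j, #{q | grp q = j} = 2 ∨ #{q | grp q = j} = 1)
    (hodd : #{j | #{q | grp q = j} = 1} < Fintype.card K)
    (hcol : ∀ γ : Γ → ℕ, ∃ f : M → ℕ, ∀ k,
      GoodAt (Sum.elim en out) (Sum.elim (fun h => f h.1) fun q => γ (grp q)) k)
    (w : K → V) (hw : w.Injective)
    (hmult : ∀ m, #{m' | s(en (m', false), en (m', true)) = s(en (m, false), en (m, true))} ≤
      mult a (w (en (m, false))) (w (en (m, true)))) : False := by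
  obtain ⟨e, he1, he2⟩ := exists_injective_of_card_fiber_le
    (fun m => s(w (en (m, false)), w (en (m, true)))) (fun e => s(a (e, false), a (e, true)))
    fun m => by
      refine le_trans (le_of_eq ?_) (hmult m)
      congr 1
      ext m'
      have := (Sym2.map.injective hw).eq_iff (a := s(en (m', false), en (m', true)))
        (b := s(en (m, false), en (m, true)))
      simpa using this
  exact hG.not_gadget en out hdeg grp hgrp hodd hcol w hw e he1 he2

/-- A gadget with four dangling half-edges, which are paired as `0, 1` and `2, 3`. The color `0` is
that of the first pair; `colEq` is used if the second pair has the same color, and `colNe` is used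
if the second pair has another color, which is called `1`. The color `2` is a new one. -/
theorem IsMinimal.not_gadget_two_pairs {k m : ℕ} [NeZero k] (hG : IsMinimal a)
    (p : Fin m → Fin k × Fin k) (out : Fin 4 → Fin k) (colEq colNe : Fin m → Fin 3)
    (hdeg : ∀ x, #{i | (p i).1 = x} + #{i | (p i).2 = x} + #{q | out q = x} = 5)
    (hEq : ∀ x, GoodAt (Sum.elim (fun h : Fin m × Bool => if h.2 then (p h.1).2 else (p h.1).1) out)
      (Sum.elim (fun h => colEq h.1) fun _ => 0) x)
    (hNe : ∀ x, GoodAt (Sum.elim (fun h : Fin m × Bool => if h.2 then (p h.1).2 else (p h.1).1) out)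
      (Sum.elim (fun h => colNe h.1) ![0, 0, 1, 1]) x)
    (w : Fin k → V) (hw : w.Injective)
    (hmult : ∀ i, #{j | s((p j).1, (p j).2) = s((p i).1, (p i).2)} ≤
      mult a (w (p i).1) (w (p i).2)) : False := by
  refine hG.not_gadget_of_mult (fun h : Fin m × Bool => if h.2 then (p h.1).2 else (p h.1).1) out
    (fun x => ?_) (![0, 0, 1, 1] : Fin 4 → Fin 2) (by decide) ?_ (fun γ => ?_) w hw
    (by simpa using hmult)
  · rw [← hdeg x]
    congr 1
    rw [← card_image_of_injective (s := {i | (p i).1 = x}) (f := fun i => (i, false))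
        fun i j h => congrArg Prod.fst h,
      ← card_image_of_injective (s := {i | (p i).2 = x}) (f := fun i => (i, true))
        fun i j h => congrArg Prod.fst h,
      ← card_union_of_disjoint]
    · congr 1
      ext ⟨i, t⟩
      cases t <;> simp
    · rw [disjoint_left]
      simp
  · have : #{j : Fin 2 | #{q | (![0, 0, 1, 1] : Fin 4 → Fin 2) q = j} = 1} = 0 := by decide
    rw [this, Fintype.card_fin]
    exact Nat.pos_of_ne_zero (NeZero.ne k)
  · obtain ⟨n, hn⟩ := exists_notMem_range γ
    by_cases hγ : γ 0 = γ 1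
    · have hinj : Function.Injective (![γ 0, n, max (γ 0) n + 1] : Fin 3 → ℕ) := by
        have := hn 0
        intro i j hij
        fin_cases i <;> fin_cases j <;> simp at hij ⊢ <;> omega
      refine ⟨fun i => (![γ 0, n, max (γ 0) n + 1] : Fin 3 → ℕ) (colEq i), fun x =>
        ((hEq x).comp_injective hinj).congr ?_⟩
      rintro (h | q) -
      · rfl
      · fin_cases q <;> simp [hγ]
    · have hinj : Function.Injective (![γ 0, γ 1, n] : Fin 3 → ℕ) := by
        have := hn 0
        have := hn 1
        intro i j hij
        fin_cases i <;> fin_cases j <;> simp at hij ⊢ <;> omega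
      refine ⟨fun i => (![γ 0, γ 1, n] : Fin 3 → ℕ) (colNe i), fun x =>
        ((hNe x).comp_injective hinj).congr ?_⟩
      rintro (h | q) -
      · rfl
      · fin_cases q <;> rfl

theorem IsMinimal.mult_lt_three (hG : IsMinimal a) {x y : V} (hxy : x ≠ y) : mult a x y < 3 := by
  by_contra! h
  refine hG.not_gadget_two_pairs ![((0 : Fin 2), (1 : Fin 2)), (0, 1), (0, 1)] ![0, 1, 0, 1]
    ![0, 0, 2] ![0, 0, 0] (by decide) (by decide) (by decide) ![x, y]
    (by intro i j; fin_cases i <;> fin_cases j <;> simp [hxy, hxy.symm]) fun i => ?_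
  refine le_trans (card_le_univ _) ?_
  fin_cases i <;> exact h

theorem IsMinimal.mult_lt_two_of_loop (hG : IsMinimal a) {x y : V} (hxy : x ≠ y)
    (hx : 1 ≤ mult a x x) : mult a x y < 2 := by
  by_contra! h
  refine hG.not_gadget_two_pairs ![((0 : Fin 2), (0 : Fin 2)), (0, 1), (0, 1)] ![0, 1, 1, 1]
    ![0, 0, 2] ![1, 1, 1] (by decide) (by decide) (by decide) ![x, y]
    (by intro i j; fin_cases i <;> fin_cases j <;> simp [hxy, hxy.symm]) fun i => ?_
  fin_cases i
  exacts [le_trans (by decide) hx, le_trans (by decide) h, le_trans (by decide) h]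

theorem IsMinimal.mult_eq_zero_of_loops (hG : IsMinimal a) {x y : V} (hxy : x ≠ y)
    (hx : 1 ≤ mult a x x) (hy : 1 ≤ mult a y y) : mult a x y = 0 := by
  by_contra h
  refine hG.not_gadget_two_pairs ![((0 : Fin 2), (0 : Fin 2)), (0, 1), (1, 1)] ![0, 1, 0, 1]
    ![0, 2, 0] ![0, 0, 0] (by decide) (by decide) (by decide) ![x, y]
    (by intro i j; fin_cases i <;> fin_cases j <;> simp [hxy, hxy.symm]) fun i => ?_
  fin_cases i
  exacts [le_trans (by decide) hx, le_trans (by decide) (Nat.pos_of_ne_zero h),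
    le_trans (by decide) hy]

/-- A vertex adjacent to four vertices with loops: the four edges get a new color, and each loop
gets the color of the two remaining half-edges at its vertex. -/
theorem IsMinimal.not_four_loop_neighbors (hG : IsMinimal a) (x : V) (y : Fin 4 → V)
    (hy : y.Injective) (hxy : ∀ i, y i ≠ x) (h1 : ∀ i, 1 ≤ mult a (y i) (y i))
    (h2 : ∀ i, 1 ≤ mult a x (y i)) : False := by
  refine hG.not_gadget_of_mult (K := Option (Fin 4)) (M := Fin 4 × Bool)
    (Q := Option (Fin 4 × Bool)) (Γ := Option (Fin 4))
    (fun h => if h.1.2 && !h.2 then none else some h.1.1) (Option.map Prod.fst) (by decide)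
    (Option.map Prod.fst) (by decide) (by decide) (fun γ => ?_) (fun k => k.elim x y) ?_ ?_
  · obtain ⟨n, hn⟩ := exists_notMem_range γ
    refine ⟨fun m => if m.2 then n else γ (some m.1), ?_⟩
    rintro (_ | j)
    · refine ⟨n, .inr none, rfl, hn none, ?_⟩
      rintro (⟨⟨i, _ | _⟩, _ | _⟩ | _ | ⟨i, t⟩) <;> simp
    · refine ⟨γ (some j), .inl ((j, true), true), rfl, (hn _).symm, ?_⟩
      rintro (⟨⟨i, _ | _⟩, _ | _⟩ | _ | ⟨i, t⟩) <;> simp <;> rintro rfl <;> simp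
  · rintro (_ | i) (_ | j) h
    · rfl
    · exact absurd h.symm (hxy j)
    · exact absurd h (hxy i)
    · exact congrArg some (hy h)
  · rintro ⟨i, _ | _⟩
    · refine le_trans ?_ (h1 i)
      revert i
      decide
    · refine le_trans ?_ (h2 i)
      revert i
      decide

/-- For `i : Fin 3` and three colors `α`, one can replace the color `α i` by another one such that
exactly two of the three colors are equal. -/
lemma exists_two_equal (α : Fin 3 → ℕ) (i : Fin 3) : ∃ s l j₀, s ≠ α i ∧
    (if i = j₀ then s else α j₀) ≠ l ∧ ∀ j, j ≠ j₀ → (if i = j then s else α j) = l := by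
  have h3 : ∀ j, j = i ∨ j = i + 1 ∨ j = i + 2 := by revert i; decide
  have h1 : i ≠ i + 1 := by revert i; decide
  have h2 : i ≠ i + 2 := by revert i; decide
  have h12 : i + 1 ≠ i + 2 := by revert i; decide
  by_cases h : α (i + 1) = α (i + 2)
  · obtain ⟨n, hn⟩ := exists_notMem_range α
    refine ⟨n, α (i + 1), i, (hn i).symm, by simpa using (hn _).symm, fun j hj => ?_⟩
    rcases h3 j with rfl | rfl | rfl
    · exact absurd rfl hj
    · simp
    · simp [h]
  · by_cases h' : α (i + 1) = α i
    · refine ⟨α (i + 2), α (i + 2), i + 1, fun h'' => h (h'.trans h''.symm), by simpa using h,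
        fun j hj => ?_⟩
      rcases h3 j with rfl | rfl | rfl
      · simp
      · exact absurd rfl hj
      · simp
    · refine ⟨α (i + 1), α (i + 1), i + 2, h', by simpa using Ne.symm h, fun j hj => ?_⟩
      rcases h3 j with rfl | rfl | rfl
      · simp
      · simp
      · exact absurd rfl hj

/-- No `K₃,₃` with loops on one side: if `α j` is the color of the two remaining half-edges at `v
j`, then `u i` and `v j` are joined in color `α j` for `i ≠ j`, and the edge from `u i` to `v i` is
the exceptional one at `v i`. -/
theorem IsMinimal.not_looped_bipartite (hG : IsMinimal a) (y v : Fin 3 → V) (hy : y.Injective)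
    (hv : v.Injective) (hyv : ∀ i j, y i ≠ v j) (h1 : ∀ i, 1 ≤ mult a (y i) (y i))
    (h2 : ∀ i j, 1 ≤ mult a (y i) (v j)) : False := by
  refine hG.not_gadget_of_mult (K := Fin 3 ⊕ Fin 3) (M := Fin 3 × Option (Fin 3))
    (Q := Fin 3 × Bool) (Γ := Fin 3)
    (fun h => if h.2 then h.1.2.elim (.inl h.1.1) .inr else .inl h.1.1) (fun q => .inr q.1)
    (by decide) Prod.fst (by decide) (by decide) (fun α => ?_) (Sum.elim y v) ?_ ?_
  · choose s l j₀ hs h₀ hl using exists_two_equal α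
    refine ⟨fun m => m.2.elim (l m.1) fun j => if m.1 = j then s m.1 else α j, ?_⟩
    rintro (i | j)
    · refine ⟨l i, .inl ((i, some (j₀ i)), false), rfl, h₀ i, ?_⟩
      rintro (⟨⟨i', _ | j⟩, _ | _⟩ | ⟨j, t⟩) <;> simp <;> rintro rfl
      · rfl
      · rfl
      · exact fun hj => hl _ j (hj rfl)
    · refine ⟨α j, .inl ((j, some j), true), rfl, by simpa using hs j, ?_⟩
      rintro (⟨⟨i', _ | j⟩, _ | _⟩ | ⟨j, t⟩) <;> simp <;> rintro rfl
      · exact fun hj => if_neg fun h => hj h rfl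
      · rfl
  · exact hy.sumElim hv hyv
  · rintro ⟨i, _ | j⟩
    · refine le_trans ?_ (h1 i)
      revert i
      decide
    · refine le_trans ?_ (h2 i j)
      revert i j
      decide

end

/-! ### Paths of double edges -/

/-- The other half of the edge to which the half-edge `h` belongs. -/
def flip {ι : Type*} (h : ι × Bool) : ι × Bool := (h.1, !h.2)

section

variable {V : Type*} {ι : Type u} {a : ι × Bool → V}

@[simp]
lemma flip_fst (h : ι × Bool) : (flip h).1 = h.1 := rfl

@[simp]
lemma flip_flip (h : ι × Bool) : flip (flip h) = h := by simp [flip]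

lemma eq_or_eq_flip {h k : ι × Bool} (hk : k.1 = h.1) : k = h ∨ k = flip h := by
  obtain ⟨i, t⟩ := h
  obtain ⟨j, s⟩ := k
  obtain rfl : j = i := hk
  cases s <;> cases t <;> simp [flip]

lemma apply_eq_or {h k : ι × Bool} (hk : k.1 = h.1) : a k = a h ∨ a k = a (flip h) :=
  (eq_or_eq_flip hk).imp (congrArg a) (congrArg a)

lemma ends_eq (h : ι × Bool) : s(a (h.1, false), a (h.1, true)) = s(a h, a (flip h)) := by
  obtain ⟨i, _ | _⟩ := h
  · rfl
  · exact Sym2.eq_swap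

lemma exists_of_ends_eq {i : ι} {x y : V} (h : s(a (i, false), a (i, true)) = s(x, y)) :
    ∃ t, a (i, t) = x ∧ a (i, !t) = y := by
  rcases Sym2.eq_iff.1 h with h | h
  exacts [⟨false, h⟩, ⟨true, h.2, h.1⟩]

variable [Fintype ι] [DecidableEq V]

lemma exists_two_edges {x y : V} (h : 2 ≤ mult a x y) : ∃ h₁ h₂ : ι × Bool, h₁.1 ≠ h₂.1 ∧
    a h₁ = x ∧ a h₂ = x ∧ a (flip h₁) = y ∧ a (flip h₂) = y := by
  obtain ⟨i, hi, j, hj, hij⟩ := one_lt_card.1 h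
  obtain ⟨t, h1, h2⟩ := exists_of_ends_eq (mem_filter.1 hi).2
  obtain ⟨s, h3, h4⟩ := exists_of_ends_eq (mem_filter.1 hj).2
  exact ⟨(i, t), (j, s), hij, h1, h3, h2, h4⟩

/-- The fifth half-edge at a vertex. -/
lemma exists_fifth {x : V} (hx : deg a x = 5) {h₁ h₂ h₃ h₄ : ι × Bool} (a1 : a h₁ = x)
    (a2 : a h₂ = x) (a3 : a h₃ = x) (a4 : a h₄ = x) (h12 : h₁ ≠ h₂) (h13 : h₁ ≠ h₃) (h14 : h₁ ≠ h₄)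
    (h23 : h₂ ≠ h₃) (h24 : h₂ ≠ h₄) (h34 : h₃ ≠ h₄) :
    ∃ h₅, a h₅ = x ∧ h₅ ≠ h₁ ∧ h₅ ≠ h₂ ∧ h₅ ≠ h₃ ∧ h₅ ≠ h₄ ∧
      ∀ h, a h = x → h = h₁ ∨ h = h₂ ∨ h = h₃ ∨ h = h₄ ∨ h = h₅ := by
  classical
  have hs : ({h₁, h₂, h₃, h₄} : Finset (ι × Bool)) ⊆
      univ.filter fun h => a h = x := by
    intro h
    simp only [mem_insert, mem_singleton, mem_filter, mem_univ, true_and]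
    rintro (rfl | rfl | rfl | rfl) <;> assumption
  have hc : #({h₁, h₂, h₃, h₄} : Finset (ι × Bool)) = 4 := by
    rw [card_insert_of_notMem, card_insert_of_notMem, card_pair h34] <;> simp [*]
  have h5 : #((univ.filter fun h => a h = x) \ ({h₁, h₂, h₃, h₄} : Finset (ι × Bool))) = 1 := by
    rw [card_sdiff_of_subset hs, hc, ← deg, hx]
  obtain ⟨h₅, hh⟩ := card_eq_one.1 h5
  have hm : ∀ h, (a h = x ∧ ¬ (h = h₁ ∨ h = h₂ ∨ h = h₃ ∨ h = h₄)) ↔ h = h₅ := fun h => by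
    simpa using congrArg (h ∈ ·) hh
  obtain ⟨g1, g2⟩ := (hm h₅).2 rfl
  push Not at g2
  refine ⟨h₅, g1, g2.1, g2.2.1, g2.2.2.1, g2.2.2.2, fun h hh => ?_⟩
  have := hm h
  tauto

end

section

variable {V : Type*} {ι : Type u} [Fintype V] [DecidableEq V] [Fintype ι] [DecidableEq ι]
  {a : ι × Bool → V}

omit [Fintype V] [DecidableEq V] [Fintype ι] [DecidableEq ι] in
/-- If two half-edges at a good vertex have different colors, one of them is the exceptional one. -/
lemma GoodAt.exists_color {c : ι × Bool → ℕ} {x : V} (hg : GoodAt a c x) {h₁ h₂ : ι × Bool}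
    (h1 : a h₁ = x) (h2 : a h₂ = x) (hne : c h₁ ≠ c h₂) : ∃ i, (i = c h₁ ∨ i = c h₂) ∧
      ∀ h, a h = x → h ≠ h₁ → h ≠ h₂ → c h = i := by
  obtain ⟨i, h₀, g1, g2, g3⟩ := hg
  by_cases h : h₁ = h₀
  · subst h
    refine ⟨i, .inr (g3 h₂ h2 ?_).symm, fun h hh n1 n2 => g3 h hh n1⟩
    rintro rfl
    exact hne rfl
  · by_cases h' : h₂ = h₀
    · subst h'
      exact ⟨i, .inl (g3 h₁ h1 h).symm, fun h hh n1 n2 => g3 h hh n2⟩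
    · exact absurd ((g3 h₁ h1 h).trans (g3 h₂ h2 h').symm) hne

/-- There is no path of three double edges. Its inner vertices are removed, its ends are joined by
two new edges and the two remaining edges at the inner vertices are spliced. If the colors of these
three edges are pairwise different, then the colors at the ends of the path have to be changed. -/
theorem IsMinimal.not_double_path (hG : IsMinimal a) {p₀ p₁ p₂ p₃ : V} (n01 : p₀ ≠ p₁)
    (n02 : p₀ ≠ p₂) (n03 : p₀ ≠ p₃) (n12 : p₁ ≠ p₂) (n13 : p₁ ≠ p₃) (n23 : p₂ ≠ p₃)
    (hA : 2 ≤ mult a p₁ p₀) (hB : 2 ≤ mult a p₁ p₂) (hC : 2 ≤ mult a p₂ p₃) : False := by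
  obtain ⟨A, A', nA, a1, a2, a3, a4⟩ := exists_two_edges hA
  obtain ⟨B, B', nB, b1, b2, b3, b4⟩ := exists_two_edges hB
  obtain ⟨C, C', nC, c1, c2, c3, c4⟩ := exists_two_edges hC
  have hne : ∀ {h k : ι × Bool} {x y z : V}, a k = x → a h = y → a (flip h) = z → y ≠ x → z ≠ x →
      h.1 ≠ k.1 := by
    rintro h k _ _ _ rfl rfl rfl g1 g2 hk
    rcases apply_eq_or (a := a) hk.symm with g | g
    exacts [g1 g.symm, g2 g.symm]
  have nAB : A.1 ≠ B.1 := hne (k := flip B) b3 a1 a3 n12 n02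
  have nAB' : A.1 ≠ B'.1 := hne (k := flip B') b4 a1 a3 n12 n02
  have nA'B : A'.1 ≠ B.1 := hne (k := flip B) b3 a2 a4 n12 n02
  have nA'B' : A'.1 ≠ B'.1 := hne (k := flip B') b4 a2 a4 n12 n02
  have nAC : A.1 ≠ C.1 := hne c1 a1 a3 n12 n02
  have nAC' : A.1 ≠ C'.1 := hne c2 a1 a3 n12 n02
  have nA'C : A'.1 ≠ C.1 := hne c1 a2 a4 n12 n02
  have nA'C' : A'.1 ≠ C'.1 := hne c2 a2 a4 n12 n02
  have nBC : B.1 ≠ C.1 := hne (k := flip C) c3 b1 b3 n13 n23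
  have nBC' : B.1 ≠ C'.1 := hne (k := flip C') c4 b1 b3 n13 n23
  have nB'C : B'.1 ≠ C.1 := hne (k := flip C) c3 b2 b4 n13 n23
  have nB'C' : B'.1 ≠ C'.1 := hne (k := flip C') c4 b2 b4 n13 n23
  have nfst : ∀ {h k : ι × Bool}, h.1 ≠ k.1 → h ≠ k := fun h g => h (congrArg Prod.fst g)
  obtain ⟨X, x1, x2, x3, x4, x5, hX⟩ := exists_fifth (hG.deg_eq p₁) a1 a2 b1 b2 (nfst nA) (nfst nAB)
    (nfst nAB') (nfst nA'B) (nfst nA'B') (nfst nB)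
  obtain ⟨Y, y1, y2, y3, y4, y5, hY⟩ := exists_fifth (hG.deg_eq p₂) b3 b4 c1 c2
    (nfst (h := flip B) (k := flip B') nB) (nfst (h := flip B) nBC) (nfst (h := flip B) nBC')
    (nfst (h := flip B') nB'C) (nfst (h := flip B') nB'C') (nfst nC)
  have hne' : ∀ {h k : ι × Bool} {x y : V}, h ≠ k → a h = x → a (flip k) = y → x ≠ y →
      h.1 ≠ k.1 := by
    rintro h k _ _ g1 rfl rfl g2 hk
    rcases eq_or_eq_flip hk with g | g
    exacts [g1 g, g2 (congrArg a g)]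
  have xA : X.1 ≠ A.1 := hne' x2 x1 a3 n01.symm
  have xA' : X.1 ≠ A'.1 := hne' x3 x1 a4 n01.symm
  have xB : X.1 ≠ B.1 := hne' x4 x1 b3 n12
  have xB' : X.1 ≠ B'.1 := hne' x5 x1 b4 n12
  have xC : X.1 ≠ C.1 := (hne x1 c1 c3 n12.symm n13.symm).symm
  have xC' : X.1 ≠ C'.1 := (hne x1 c2 c4 n12.symm n13.symm).symm
  have yA : Y.1 ≠ A.1 := (hne y1 a1 a3 n12 n02).symm
  have yA' : Y.1 ≠ A'.1 := (hne y1 a2 a4 n12 n02).symm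
  have yB : Y.1 ≠ B.1 := hne' (k := flip B) y2 y1 (by rw [flip_flip, b1]) n12.symm
  have yB' : Y.1 ≠ B'.1 := hne' (k := flip B') y3 y1 (by rw [flip_flip, b2]) n12.symm
  have yC : Y.1 ≠ C.1 := hne' y4 y1 c3 n23
  have yC' : Y.1 ≠ C'.1 := hne' y5 y1 c4 n23
  have hXY : X ≠ Y := fun h => n12 (by rw [← x1, h, y1])
  -- the three pairs of half-edges at the inner vertices
  let g : ι × Bool → Fin 3 := fun h =>
    if h.1 = A.1 ∨ h.1 = C.1 then 0 else if h.1 = A'.1 ∨ h.1 = C'.1 then 1 else 2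
  have gA : g A = 0 := by simp [g]
  have gA' : g A' = 1 := by simp [g, nA.symm, nA'C]
  have gC : g C = 0 := by simp [g]
  have gC' : g C' = 1 := by simp [g, nC.symm, nAC'.symm]
  have gX : g X = 2 := by simp [g, xA, xA', xC, xC']
  have gY : g Y = 2 := by simp [g, yA, yA', yC, yC']
  have mouts : ∀ h, h ∈ outs a {p₁, p₂} {B.1, B'.1} ↔
      h = A ∨ h = A' ∨ h = X ∨ h = C ∨ h = C' ∨ h = Y := by
    intro h
    simp only [mem_outs, mem_insert, mem_singleton, not_or]
    constructor
    · rintro ⟨h1 | h1, h2, h3⟩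
      · rcases hX h h1 with g | g | rfl | rfl | g
        exacts [.inl g, .inr (.inl g), absurd rfl h2, absurd rfl h3, .inr (.inr (.inl g))]
      · rcases hY h h1 with rfl | rfl | g | g | g
        exacts [absurd rfl h2, absurd rfl h3, .inr (.inr (.inr (.inl g))),
          .inr (.inr (.inr (.inr (.inl g)))), .inr (.inr (.inr (.inr (.inr g))))]
    · rintro (rfl | rfl | rfl | rfl | rfl | rfl)
      exacts [⟨.inl a1, nAB, nAB'⟩, ⟨.inl a2, nA'B, nA'B'⟩, ⟨.inl x1, xB, xB'⟩,
        ⟨.inr c1, nBC.symm, nB'C.symm⟩, ⟨.inr c2, nBC'.symm, nB'C'.symm⟩, ⟨.inr y1, yB, yB'⟩]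
  have hcard : ∀ j, #{h ∈ outs a {p₁, p₂} {B.1, B'.1} | g h = j} = 2 := by
    have e0 : {h ∈ outs a {p₁, p₂} {B.1, B'.1} | g h = 0} = {A, C} := by
      ext h
      simp only [mem_filter, mouts, mem_insert, mem_singleton]
      constructor
      · rintro ⟨rfl | rfl | rfl | rfl | rfl | rfl, hh⟩
        exacts [.inl rfl, absurd (gA'.symm.trans hh) (by decide),
          absurd (gX.symm.trans hh) (by decide), .inr rfl,
          absurd (gC'.symm.trans hh) (by decide), absurd (gY.symm.trans hh) (by decide)]
      · rintro (rfl | rfl)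
        exacts [⟨by simp, gA⟩, ⟨by simp, gC⟩]
    have e1 : {h ∈ outs a {p₁, p₂} {B.1, B'.1} | g h = 1} = {A', C'} := by
      ext h
      simp only [mem_filter, mouts, mem_insert, mem_singleton]
      constructor
      · rintro ⟨rfl | rfl | rfl | rfl | rfl | rfl, hh⟩
        exacts [absurd (gA.symm.trans hh) (by decide), .inl rfl,
          absurd (gX.symm.trans hh) (by decide), absurd (gC.symm.trans hh) (by decide),
          .inr rfl, absurd (gY.symm.trans hh) (by decide)]
      · rintro (rfl | rfl)
        exacts [⟨by simp, gA'⟩, ⟨by simp, gC'⟩]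
    have e2 : {h ∈ outs a {p₁, p₂} {B.1, B'.1} | g h = 2} = {X, Y} := by
      ext h
      simp only [mem_filter, mouts, mem_insert, mem_singleton]
      constructor
      · rintro ⟨rfl | rfl | rfl | rfl | rfl | rfl, hh⟩
        exacts [absurd (gA.symm.trans hh) (by decide), absurd (gA'.symm.trans hh) (by decide),
          .inl rfl, absurd (gC.symm.trans hh) (by decide),
          absurd (gC'.symm.trans hh) (by decide), .inr rfl]
      · rintro (rfl | rfl)
        exacts [⟨by simp, gX⟩, ⟨by simp, gY⟩]
    intro j
    fin_cases j
    · exact (congrArg card e0).trans (card_pair (nfst nAC))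
    · exact (congrArg card e1).trans (card_pair (nfst nA'C'))
    · exact (congrArg card e2).trans (card_pair hXY)
  obtain ⟨c, hc1, -, hc2⟩ := hG.exists_coloring_off {p₁, p₂} {B.1, B'.1}
    (fun h hh => by
      simp only [mem_insert, mem_singleton] at hh ⊢
      rcases hh with hh | hh
      · rcases apply_eq_or (a := a) hh with h | h
        exacts [.inl (h.trans b1), .inr (h.trans b3)]
      · rcases apply_eq_or (a := a) hh with h | h
        exacts [.inl (h.trans b2), .inr (h.trans b4)])
    g (fun j _ => by rw [hcard]; decide) (by simp [hcard, n12, show ¬ Odd 2 by decide])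
  have cAC : c C.1 = c A.1 :=
    hc2 0 (hcard 0) _ ((mouts _).2 (by simp)) _ ((mouts _).2 (by simp)) gC gA
  have cAC' : c C'.1 = c A'.1 :=
    hc2 1 (hcard 1) _ ((mouts _).2 (by simp)) _ ((mouts _).2 (by simp)) gC' gA'
  have cXY : c Y.1 = c X.1 :=
    hc2 2 (hcard 2) _ ((mouts _).2 (by simp)) _ ((mouts _).2 (by simp)) gY gX
  have hp0 := hc1 p₀ (by simp [n01, n02])
  have hp3 := hc1 p₃ (by simp [n13.symm, n23.symm])
  -- a recoloring of the six edges of the path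
  let r : ℕ → ℕ → ℕ → ℕ → ℕ → ℕ → ι → ℕ := fun α α' β β' γ γ' i =>
    if i = A.1 then α else if i = A'.1 then α' else if i = B.1 then β else if i = B'.1 then β' else
    if i = C.1 then γ else if i = C'.1 then γ' else c i
  have hr0 : ∀ α α' β β' γ γ' h, a h = p₀ → r α α' β β' γ γ' h.1 =
      if h.1 = A.1 then α else if h.1 = A'.1 then α' else c h.1 := by
    intro α α' β β' γ γ' h hh
    simp only [r, if_neg (hne hh b1 b3 n01.symm n02.symm).symm,
      if_neg (hne hh b2 b4 n01.symm n02.symm).symm, if_neg (hne hh c1 c3 n02.symm n03.symm).symm,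
      if_neg (hne hh c2 c4 n02.symm n03.symm).symm]
  have hr3 : ∀ α α' β β' γ γ' h, a h = p₃ → r α α' β β' γ γ' h.1 =
      if h.1 = C.1 then γ else if h.1 = C'.1 then γ' else c h.1 := by
    intro α α' β β' γ γ' h hh
    simp only [r, if_neg (hne hh b1 b3 n13 n23).symm, if_neg (hne hh b2 b4 n13 n23).symm,
      if_neg (hne hh a1 a3 n13 n03).symm, if_neg (hne hh a2 a4 n13 n03).symm]
  have key : ∀ α α' β β' γ γ',
      GoodAt (fun _ : Fin 5 => ()) ![α, α', β, β', c X.1] () →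
      GoodAt (fun _ : Fin 5 => ()) ![β, β', γ, γ', c X.1] () →
      GoodAt a (fun h => r α α' β β' γ γ' h.1) p₀ →
      GoodAt a (fun h => r α α' β β' γ γ' h.1) p₃ → False := by
    intro α α' β β' γ γ' h1 h2 h0 h3
    refine hG.not_colorable ⟨r α α' β β' γ γ', fun x => ?_⟩
    by_cases e0 : x = p₀
    · rwa [e0]
    by_cases e3 : x = p₃
    · rwa [e3]
    by_cases e1 : x = p₁
    · subst e1
      refine h1.map ![A, A', B, B', X] (fun i => ?_) (fun h hh => ?_) fun i _ => ?_
      · fin_cases i <;> simp [a1, a2, b1, b2, x1]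
      · rcases hX h hh with rfl | rfl | rfl | rfl | rfl
        exacts [⟨0, rfl⟩, ⟨1, rfl⟩, ⟨2, rfl⟩, ⟨3, rfl⟩, ⟨4, rfl⟩]
      · fin_cases i <;> simp [r, nA.symm, nAB.symm, nAB'.symm, nA'B.symm, nA'B'.symm, nB.symm,
          xA, xA', xB, xB', xC, xC']
    by_cases e2 : x = p₂
    · subst e2
      refine h2.map ![flip B, flip B', C, C', Y] (fun i => ?_) (fun h hh => ?_) fun i _ => ?_
      · fin_cases i <;> simp [b3, b4, c1, c2, y1]
      · rcases hY h hh with rfl | rfl | rfl | rfl | rfl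
        exacts [⟨0, rfl⟩, ⟨1, rfl⟩, ⟨2, rfl⟩, ⟨3, rfl⟩, ⟨4, rfl⟩]
      · fin_cases i <;> simp [r, nAB.symm, nAB'.symm, nA'B.symm, nA'B'.symm, nB.symm,
          nAC.symm, nAC'.symm, nA'C.symm, nA'C'.symm, nBC.symm, nBC'.symm, nB'C.symm, nB'C'.symm,
          nC.symm, yA, yA', yB, yB', yC, yC', cXY]
    · refine (hc1 x (by simp [e1, e2])).congr fun h hh => ?_
      have q0 := Ne.symm e0
      have q1 := Ne.symm e1
      have q2 := Ne.symm e2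
      have q3 := Ne.symm e3
      simp only [r, if_neg (hne hh a1 a3 q1 q0).symm, if_neg (hne hh a2 a4 q1 q0).symm,
        if_neg (hne hh b1 b3 q1 q2).symm, if_neg (hne hh b2 b4 q1 q2).symm,
        if_neg (hne hh c1 c3 q2 q3).symm, if_neg (hne hh c2 c4 q2 q3).symm]
  -- as long as the four outer edges keep their colors, the ends of the path stay good
  have key' : ∀ β β', GoodAt (fun _ : Fin 5 => ()) ![c A.1, c A'.1, β, β', c X.1] () →
      GoodAt (fun _ : Fin 5 => ()) ![β, β', c A.1, c A'.1, c X.1] () → False := by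
    intro β β' h1 h2
    refine key _ _ β β' _ _ h1 h2 (hp0.congr fun h hh => ?_) (hp3.congr fun h hh => ?_)
    · rw [hr0 _ _ _ _ _ _ h hh]
      split_ifs with g1 g2
      exacts [by rw [g1], by rw [g2], rfl]
    · rw [hr3 _ _ _ _ _ _ h hh]
      split_ifs with g1 g2
      exacts [by rw [g1, cAC], by rw [g2, cAC'], rfl]
  by_cases hxy : c A'.1 = c A.1
  · rw [hxy] at key'
    by_cases hzx : c X.1 = c A.1
    · rw [hzx] at key'
      exact key' (c A.1) (c A.1 + 1)
        ⟨c A.1, 3, rfl, by simp, fun i _ hi => by fin_cases i <;> simp at hi ⊢⟩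
        ⟨c A.1, 1, rfl, by simp, fun i _ hi => by fin_cases i <;> simp at hi ⊢⟩
    · exact key' (c A.1) (c A.1)
        ⟨c A.1, 4, rfl, by simpa using hzx, fun i _ hi => by fin_cases i <;> simp at hi ⊢⟩
        ⟨c A.1, 4, rfl, by simpa using hzx, fun i _ hi => by fin_cases i <;> simp at hi ⊢⟩
  by_cases hzx : c X.1 = c A.1
  · rw [hzx] at key'
    exact key' (c A.1) (c A.1)
      ⟨c A.1, 1, rfl, by simpa using hxy, fun i _ hi => by fin_cases i <;> simp at hi ⊢⟩
      ⟨c A.1, 3, rfl, by simpa using hxy, fun i _ hi => by fin_cases i <;> simp at hi ⊢⟩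
  by_cases hzy : c X.1 = c A'.1
  · rw [hzy] at key'
    exact key' (c A'.1) (c A'.1)
      ⟨c A'.1, 0, rfl, by simpa using Ne.symm hxy, fun i _ hi => by fin_cases i <;> simp at hi ⊢⟩
      ⟨c A'.1, 2, rfl, by simpa using Ne.symm hxy, fun i _ hi => by fin_cases i <;> simp at hi ⊢⟩
  -- now all other half-edges at `p₀` have one color, and likewise at `p₃`
  obtain ⟨i, hi1, hi2⟩ := hp0.exists_color a3 a4 (Ne.symm hxy)
  obtain ⟨j, hj1, hj2⟩ := hp3.exists_color c3 c4 (by simpa [cAC, cAC'] using Ne.symm hxy)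
  have hi : c X.1 ≠ i := by rcases hi1 with rfl | rfl <;> assumption
  have hj : c X.1 ≠ j := by
    rcases hj1 with rfl | rfl
    · simpa [cAC] using hzx
    · simpa [cAC'] using hzy
  refine key i (c X.1) (c X.1) (c X.1) j (c X.1)
    ⟨c X.1, 0, rfl, by simpa using hi.symm, fun i _ hi => by fin_cases i <;> simp at hi ⊢⟩
    ⟨c X.1, 2, rfl, by simpa using hj.symm, fun i _ hi => by fin_cases i <;> simp at hi ⊢⟩
    ⟨i, flip A', a4, ?_, fun h hh hne => ?_⟩ ⟨j, flip C', c4, ?_, fun h hh hne => ?_⟩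
  · beta_reduce
    rw [hr0 _ _ _ _ _ _ _ a4]
    simpa [nA.symm] using hi
  · beta_reduce
    rw [hr0 _ _ _ _ _ _ h hh]
    split_ifs with g1 g2
    · rfl
    · rcases eq_or_eq_flip g2 with rfl | rfl
      exacts [absurd (hh.symm.trans a2) n01, absurd rfl hne]
    · exact hi2 h hh (fun g => g1 (by rw [g]; rfl)) hne
  · beta_reduce
    rw [hr3 _ _ _ _ _ _ _ c4]
    simpa [nC.symm] using hj
  · beta_reduce
    rw [hr3 _ _ _ _ _ _ h hh]
    split_ifs with g1 g2
    · rfl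
    · rcases eq_or_eq_flip g2 with rfl | rfl
      exacts [absurd (c2.symm.trans hh) n23, absurd rfl hne]
    · exact hj2 h hh (fun g => g1 (by rw [g]; rfl)) hne

end

/-! ### Multigraphs with four vertices and eight edges -/

section

variable {V : Type*} {ι : Type u} [Fintype V] [DecidableEq V] [Fintype ι] [DecidableEq ι]
  {a : ι × Bool → V}

/-- A doubled triangle is `4`-regular. -/
theorem IsMinimal.not_double_triangle (hG : IsMinimal a) {x y z : V} (hxy : x ≠ y) (hxz : x ≠ z)
    (hyz : y ≠ z) (h1 : 2 ≤ mult a x y) (h2 : 2 ≤ mult a x z) (h3 : 2 ≤ mult a y z) : False := by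
  let p : Fin 6 → Fin 3 × Fin 3 := ![(0, 1), (0, 1), (0, 2), (0, 2), (1, 2), (1, 2)]
  refine hG.not_gadget_of_mult (fun h : Fin 6 × Bool => if h.2 then (p h.1).2 else (p h.1).1)
    (id : Fin 3 → Fin 3) (by decide) (![0, 0, 1] : Fin 3 → Fin 2) (by decide) (by decide)
    (fun γ => ?_) ![x, y, z]
    (by intro i j; fin_cases i <;> fin_cases j <;> simp [hxy, hxz, hyz, hxy.symm, hxz.symm,
      hyz.symm]) fun i => ?_
  · obtain ⟨n, hn⟩ := exists_notMem_range γ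
    refine ⟨fun _ => n, fun k => ⟨n, .inr k, rfl, hn _, ?_⟩⟩
    rintro (h | q) hh hne
    · rfl
    · exact absurd (congrArg Sum.inr hh) hne
  · fin_cases i
    exacts [le_trans (by decide) h1, le_trans (by decide) h1, le_trans (by decide) h2,
      le_trans (by decide) h2, le_trans (by decide) h3, le_trans (by decide) h3]

/-- Two vertices with two loops each form a `4`-regular subgraph. -/
theorem IsMinimal.not_double_loops (hG : IsMinimal a) {x y : V} (hxy : x ≠ y)
    (h1 : 2 ≤ mult a x x) (h2 : 2 ≤ mult a y y) : False := by
  let p : Fin 4 → Fin 2 × Fin 2 := ![(0, 0), (0, 0), (1, 1), (1, 1)]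
  refine hG.not_gadget_of_mult (fun h : Fin 4 × Bool => if h.2 then (p h.1).2 else (p h.1).1)
    (id : Fin 2 → Fin 2) (by decide) (![0, 0] : Fin 2 → Fin 1) (by decide) (by decide)
    (fun γ => ?_) ![x, y]
    (by intro i j; fin_cases i <;> fin_cases j <;> simp [hxy, hxy.symm]) fun i => ?_
  · obtain ⟨n, hn⟩ := exists_notMem_range γ
    refine ⟨fun _ => n, fun k => ⟨n, .inr k, rfl, hn _, ?_⟩⟩
    rintro (h | q) hh hne
    · rfl
    · exact absurd (congrArg Sum.inr hh) hne
  · fin_cases i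
    exacts [le_trans (by decide) h1, le_trans (by decide) h1, le_trans (by decide) h2,
      le_trans (by decide) h2]

/-- Seven multigraphs on four vertices `i, j, k, l` with eight edges, as conditions on the
multiplicities `m`: one without loops, two in which only `i` has loops, and these are two, three in
which `i` has one loop, and one in which `i` has two loops and `j` has one. -/
def IsDense (m : Fin 4 → Fin 4 → ℕ) (i j k l : Fin 4) : Prop :=
  2 ≤ m i j ∧ 2 ≤ m i k ∧ 1 ≤ m i l ∧ 1 ≤ m j k ∧ 1 ≤ m j l ∧ 1 ≤ m k l ∨
  2 ≤ m i i ∧ 1 ≤ m i j ∧ 2 ≤ m j k ∧ 2 ≤ m j l ∧ 1 ≤ m k l ∨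
  2 ≤ m i i ∧ 1 ≤ m i k ∧ 2 ≤ m j k ∧ 2 ≤ m j l ∧ 1 ≤ m k l ∨
  1 ≤ m i i ∧ 1 ≤ m i j ∧ 1 ≤ m i k ∧ 1 ≤ m i l ∧ 2 ≤ m j k ∧ 2 ≤ m j l ∨
  1 ≤ m i i ∧ 1 ≤ m i j ∧ 1 ≤ m i k ∧ 1 ≤ m i l ∧ 2 ≤ m j k ∧ 1 ≤ m j l ∧ 1 ≤ m k l ∨
  1 ≤ m i i ∧ 1 ≤ m i j ∧ 1 ≤ m i k ∧ 2 ≤ m j k ∧ 2 ≤ m j l ∧ 1 ≤ m k l ∨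
  2 ≤ m i i ∧ 1 ≤ m j j ∧ 1 ≤ m i k ∧ 1 ≤ m j k ∧ 1 ≤ m j l ∧ 2 ≤ m k l

instance (m : Fin 4 → Fin 4 → ℕ) (i j k l : Fin 4) : Decidable (IsDense m i j k l) := by
  unfold IsDense; infer_instance

/-- None of the seven multigraphs occurs. They have four dangling half-edges, which are paired. -/
theorem IsMinimal.not_isDense (hG : IsMinimal a) {w : Fin 4 → V} (hw : w.Injective)
    (h : IsDense (fun i j => mult a (w i) (w j)) 0 1 2 3) : False := by
  rcases h with ⟨h1, h2, h3, h4, h5, h6⟩ | ⟨h1, h2, h3, h4, h5⟩ | ⟨h1, h2, h3, h4, h5⟩ |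
    ⟨h1, h2, h3, h4, h5, h6⟩ | ⟨h1, h2, h3, h4, h5, h6, h7⟩ | ⟨h1, h2, h3, h4, h5, h6⟩ |
    ⟨h1, h2, h3, h4, h5, h6⟩
  · refine hG.not_gadget_two_pairs
      ![((0 : Fin 4), (1 : Fin 4)), (0, 1), (0, 2), (0, 2), (0, 3), (1, 2), (1, 3), (2, 3)]
      ![1, 2, 3, 3] ![0, 0, 0, 0, 2, 2, 0, 0] ![0, 0, 0, 0, 2, 0, 1, 1]
      (by decide) (by decide +kernel) (by decide +kernel) w hw fun i => ?_
    fin_cases i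
    exacts [le_trans (by decide) h1, le_trans (by decide) h1, le_trans (by decide) h2,
      le_trans (by decide) h2, le_trans (by decide) h3, le_trans (by decide) h4,
      le_trans (by decide) h5, le_trans (by decide) h6]
  · refine hG.not_gadget_two_pairs
      ![((0 : Fin 4), (0 : Fin 4)), (0, 0), (0, 1), (1, 2), (1, 2), (1, 3), (1, 3), (2, 3)]
      ![2, 3, 2, 3] ![0, 0, 2, 0, 0, 0, 0, 2] ![0, 0, 2, 0, 0, 0, 0, 0]
      (by decide) (by decide +kernel) (by decide +kernel) w hw fun i => ?_
    fin_cases i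
    exacts [le_trans (by decide) h1, le_trans (by decide) h1, le_trans (by decide) h2,
      le_trans (by decide) h3, le_trans (by decide) h3, le_trans (by decide) h4,
      le_trans (by decide) h4, le_trans (by decide) h5]
  · refine hG.not_gadget_two_pairs
      ![((0 : Fin 4), (0 : Fin 4)), (0, 0), (0, 2), (1, 2), (1, 2), (1, 3), (1, 3), (2, 3)]
      ![1, 2, 3, 3] ![0, 0, 2, 0, 0, 0, 2, 0] ![1, 1, 0, 0, 0, 1, 0, 1]
      (by decide) (by decide +kernel) (by decide +kernel) w hw fun i => ?_
    fin_cases i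
    exacts [le_trans (by decide) h1, le_trans (by decide) h1, le_trans (by decide) h2,
      le_trans (by decide) h3, le_trans (by decide) h3, le_trans (by decide) h4,
      le_trans (by decide) h4, le_trans (by decide) h5]
  · refine hG.not_gadget_two_pairs
      ![((0 : Fin 4), (0 : Fin 4)), (0, 1), (0, 2), (0, 3), (1, 2), (1, 2), (1, 3), (1, 3)]
      ![2, 3, 2, 3] ![0, 0, 2, 0, 0, 0, 0, 2] ![0, 2, 0, 0, 0, 0, 0, 0]
      (by decide) (by decide +kernel) (by decide +kernel) w hw fun i => ?_
    fin_cases i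
    exacts [le_trans (by decide) h1, le_trans (by decide) h2, le_trans (by decide) h3,
      le_trans (by decide) h4, le_trans (by decide) h5, le_trans (by decide) h5,
      le_trans (by decide) h6, le_trans (by decide) h6]
  · refine hG.not_gadget_two_pairs
      ![((0 : Fin 4), (0 : Fin 4)), (0, 1), (0, 2), (0, 3), (1, 2), (1, 2), (1, 3), (2, 3)]
      ![1, 2, 3, 3] ![0, 0, 0, 2, 0, 2, 0, 0] ![0, 0, 0, 2, 0, 0, 1, 1]
      (by decide) (by decide +kernel) (by decide +kernel) w hw fun i => ?_
    fin_cases i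
    exacts [le_trans (by decide) h1, le_trans (by decide) h2, le_trans (by decide) h3,
      le_trans (by decide) h4, le_trans (by decide) h5, le_trans (by decide) h5,
      le_trans (by decide) h6, le_trans (by decide) h7]
  · refine hG.not_gadget_two_pairs
      ![((0 : Fin 4), (0 : Fin 4)), (0, 1), (0, 2), (1, 2), (1, 2), (1, 3), (1, 3), (2, 3)]
      ![0, 2, 3, 3] ![0, 2, 0, 0, 0, 0, 0, 2] ![0, 1, 0, 1, 0, 1, 1, 0]
      (by decide) (by decide +kernel) (by decide +kernel) w hw fun i => ?_
    fin_cases i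
    exacts [le_trans (by decide) h1, le_trans (by decide) h2, le_trans (by decide) h3,
      le_trans (by decide) h4, le_trans (by decide) h4, le_trans (by decide) h5,
      le_trans (by decide) h5, le_trans (by decide) h6]
  · refine hG.not_gadget_two_pairs
      ![((0 : Fin 4), (0 : Fin 4)), (0, 0), (1, 1), (0, 2), (1, 2), (1, 3), (2, 3), (2, 3)]
      ![2, 1, 3, 3] ![0, 0, 0, 2, 0, 2, 0, 0] ![1, 1, 0, 0, 0, 1, 1, 0]
      (by decide) (by decide +kernel) (by decide +kernel) w hw fun i => ?_
    fin_cases i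
    exacts [le_trans (by decide) h1, le_trans (by decide) h1, le_trans (by decide) h2,
      le_trans (by decide) h3, le_trans (by decide) h4, le_trans (by decide) h5,
      le_trans (by decide) h6, le_trans (by decide) h6]

end

/-- The multiplicity matrix of a multigraph on four vertices. -/
def multMatrix (l₀ l₁ l₂ l₃ m₀₁ m₀₂ m₀₃ m₁₂ m₁₃ m₂₃ : ℕ) : Fin 4 → Fin 4 → ℕ :=
  ![![l₀, m₀₁, m₀₂, m₀₃], ![m₀₁, l₁, m₁₂, m₁₃], ![m₀₂, m₁₂, l₂, m₂₃], ![m₀₃, m₁₃, m₂₃, l₃]]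

/-- The numbers `k, l` of loops at two vertices and the number `m` of edges joining them do not
contradict the results on loops and parallel edges. -/
def Compatible (k l m : ℕ) : Prop :=
  (1 ≤ k → m ≤ 1) ∧ (1 ≤ l → m ≤ 1) ∧ (1 ≤ k → 1 ≤ l → m = 0)

instance (k l m : ℕ) : Decidable (Compatible k l m) := by
  unfold Compatible; infer_instance

/-- For some order `i, j, k, l` of the four vertices, there is a doubled triangle on `i, j, k`, a
path of three double edges, or one of the seven multigraphs of `IsDense`. -/
def HasForbidden (m : Fin 4 → Fin 4 → ℕ) : Prop :=
  ∃ i j, i ≠ j ∧ ∃ k, i ≠ k ∧ j ≠ k ∧ ∃ l, i ≠ l ∧ j ≠ l ∧ k ≠ l ∧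
    (2 ≤ m i j ∧ 2 ≤ m j k ∧ 2 ≤ m i k ∨ 2 ≤ m i j ∧ 2 ≤ m j k ∧ 2 ≤ m k l ∨ IsDense m i j k l)

instance (m : Fin 4 → Fin 4 → ℕ) : Decidable (HasForbidden m) := by
  unfold HasForbidden; infer_instance

set_option synthInstance.maxHeartbeats 200000 in
set_option synthInstance.maxSize 1000 in
set_option maxRecDepth 2000 in
/-- Enumeration of the multigraphs on four vertices with `lᵢ` loops and `mᵢⱼ` other edges, eight in
total: if the degrees are at most `5` but not all equal to `4`, the multiplicities are at most `2`,
only one vertex has two loops, and loops are as far from each other and from double edges as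
`Compatible` requires, then there is a forbidden configuration. The hypotheses are interleaved with
the quantifiers to cut the enumeration short. -/
lemma hasForbidden_of_card_eq_eight : ∀ l₀ : Fin 3, ∀ l₁ : Fin 3, (l₀ = 2 → l₁ ≠ 2) →
    ∀ l₂ : Fin 3, (l₀ = 2 → l₂ ≠ 2) → (l₁ = 2 → l₂ ≠ 2) →
    ∀ l₃ : Fin 3, (l₀ = 2 → l₃ ≠ 2) → (l₁ = 2 → l₃ ≠ 2) → (l₂ = 2 → l₃ ≠ 2) →
    ∀ m₀₁ : Fin 3, Compatible l₀.val l₁.val m₀₁.val →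
    ∀ m₀₂ : Fin 3, Compatible l₀.val l₂.val m₀₂.val →
    ∀ m₀₃ : Fin 3, Compatible l₀.val l₃.val m₀₃.val → 2 * l₀.val + m₀₁.val + m₀₂.val + m₀₃ ≤ 5 →
    ∀ m₁₂ : Fin 3, Compatible l₁.val l₂.val m₁₂.val →
    ∀ m₁₃ : Fin 3, Compatible l₁.val l₃.val m₁₃.val →
    m₀₁.val + 2 * l₁.val + m₁₂ + m₁₃ ≤ 5 → ∀ m₂₃ : Fin 3, Compatible l₂.val l₃.val m₂₃.val →
    m₀₂.val + m₁₂ + 2 * l₂ + m₂₃ ≤ 5 → m₀₃.val + m₁₃ + m₂₃ + 2 * l₃ ≤ 5 →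
    l₀.val + l₁ + l₂ + l₃ + m₀₁.val + m₀₂.val + m₀₃ + m₁₂ + m₁₃ + m₂₃ = 8 →
    ¬ (2 * l₀.val + m₀₁.val + m₀₂.val + m₀₃ = 4 ∧ m₀₁.val + 2 * l₁.val + m₁₂ + m₁₃ = 4 ∧
      m₀₂.val + m₁₂ + 2 * l₂ + m₂₃ = 4 ∧ m₀₃.val + m₁₃ + m₂₃ + 2 * l₃ = 4) →
    HasForbidden (multMatrix l₀ l₁ l₂ l₃ m₀₁ m₀₂ m₀₃ m₁₂ m₁₃ m₂₃) := by
  decide +kernel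

/-! ### Dense subgraphs on four vertices -/

lemma IsDense.mono {m m' : Fin 4 → Fin 4 → ℕ} (hm : ∀ i j, m i j ≤ m' i j) {i j k l : Fin 4}
    (h : IsDense m i j k l) : IsDense m' i j k l := by
  have h' : ∀ n i j, n ≤ m i j → n ≤ m' i j := fun n i j h => h.trans (hm i j)
  unfold IsDense at h ⊢
  refine h.imp ?_ (Or.imp ?_ (Or.imp ?_ (Or.imp ?_ (Or.imp ?_ (Or.imp ?_ ?_)))))
  · exact fun ⟨h1, h2, h3, h4, h5, h6⟩ =>
      ⟨h' _ _ _ h1, h' _ _ _ h2, h' _ _ _ h3, h' _ _ _ h4, h' _ _ _ h5, h' _ _ _ h6⟩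
  · exact fun ⟨h1, h2, h3, h4, h5⟩ =>
      ⟨h' _ _ _ h1, h' _ _ _ h2, h' _ _ _ h3, h' _ _ _ h4, h' _ _ _ h5⟩
  · exact fun ⟨h1, h2, h3, h4, h5⟩ =>
      ⟨h' _ _ _ h1, h' _ _ _ h2, h' _ _ _ h3, h' _ _ _ h4, h' _ _ _ h5⟩
  · exact fun ⟨h1, h2, h3, h4, h5, h6⟩ =>
      ⟨h' _ _ _ h1, h' _ _ _ h2, h' _ _ _ h3, h' _ _ _ h4, h' _ _ _ h5, h' _ _ _ h6⟩
  · exact fun ⟨h1, h2, h3, h4, h5, h6, h7⟩ => ⟨h' _ _ _ h1, h' _ _ _ h2, h' _ _ _ h3,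
      h' _ _ _ h4, h' _ _ _ h5, h' _ _ _ h6, h' _ _ _ h7⟩
  · exact fun ⟨h1, h2, h3, h4, h5, h6⟩ =>
      ⟨h' _ _ _ h1, h' _ _ _ h2, h' _ _ _ h3, h' _ _ _ h4, h' _ _ _ h5, h' _ _ _ h6⟩
  · exact fun ⟨h1, h2, h3, h4, h5, h6⟩ =>
      ⟨h' _ _ _ h1, h' _ _ _ h2, h' _ _ _ h3, h' _ _ _ h4, h' _ _ _ h5, h' _ _ _ h6⟩

section

variable {V : Type*} {ι : Type u} [DecidableEq V] [Fintype ι] [DecidableEq ι]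
  {a : ι × Bool → V}

lemma card_filter_halves (F : Finset ι) (x : V) : #{h | a h = x ∧ h.1 ∈ F} =
    ∑ e ∈ F, ((if a (e, false) = x then 1 else 0) + if a (e, true) = x then 1 else 0) := by
  rw [card_filter, Fintype.sum_prod_type, ← sum_subset (subset_univ F)]
  · refine sum_congr rfl fun e he => ?_
    simp only [he, and_true, Fintype.sum_bool, add_comm]
  · intro e _ he
    simp [he]

/-- Degrees in terms of multiplicities. -/
lemma card_filter_halves_eq_sum {w : Fin 4 → V} (hw : w.Injective) {F : Finset ι}
    (hF : ∀ e ∈ F, ∀ t, a (e, t) ∈ Set.range w) (i : Fin 4) : #{h | a h = w i ∧ h.1 ∈ F} =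
    ∑ j, (if j = i then 2 else 1) * #{e ∈ F | s(a (e, false), a (e, true)) = s(w i, w j)} := by
  rw [card_filter_halves]
  simp only [card_filter, mul_sum]
  rw [sum_comm]
  refine sum_congr rfl fun e he => ?_
  obtain ⟨p, hp⟩ := hF e he false
  obtain ⟨q, hq⟩ := hF e he true
  rw [← hp, ← hq]
  have : ∀ j, s(w p, w q) = s(w i, w j) ↔ s(p, q) = s(i, j) := fun j => by
    simpa using (Sym2.map.injective hw).eq_iff (a := s(p, q)) (b := s(i, j))
  simp only [this, hw.eq_iff]
  clear this hp hq
  revert p q i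
  decide

variable [Fintype V]

/-- Four vertices do not span eight edges. -/
theorem IsMinimal.not_eight_edges (hG : IsMinimal a) {w : Fin 4 → V} (hw : w.Injective)
    (F : Finset ι) (hcard : #F = 8) (hF : ∀ e ∈ F, ∀ t, a (e, t) ∈ Set.range w) : False := by
  set m : Fin 4 → Fin 4 → ℕ :=
    fun i j => #{e ∈ F | s(a (e, false), a (e, true)) = s(w i, w j)} with hm
  have hsymm : ∀ i j, m i j = m j i := fun i j => by simp only [hm, Sym2.eq_swap]
  have hle : ∀ i j, m i j ≤ mult a (w i) (w j) := fun i j =>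
    card_le_card (filter_subset_filter _ (subset_univ F))
  have hD : ∀ i, #{h | a h = w i ∧ h.1 ∈ F} = ∑ j, (if j = i then 2 else 1) * m i j :=
    card_filter_halves_eq_sum hw hF
  have hD5 : ∀ i, ∑ j, (if j = i then 2 else 1) * m i j ≤ 5 := fun i => by
    rw [← hD, ← hG.deg_eq (w i)]
    exact card_le_card fun h hh => by simp_all
  have hsum : ∑ i, ∑ j, (if j = i then 2 else 1) * m i j = 16 := by
    simp only [← hD, card_filter_halves]
    rw [sum_comm, sum_const_nat (m := 2), hcard]
    intro e he
    obtain ⟨p, hp⟩ := hF e he false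
    obtain ⟨q, hq⟩ := hF e he true
    simp [← hp, ← hq, hw.eq_iff, sum_add_distrib]
  have hne : ∀ {i j}, i ≠ j → w i ≠ w j := fun h => hw.ne h
  have h3 : ∀ i j, i ≠ j → m i j < 3 := fun i j h =>
    (hle i j).trans_lt (hG.mult_lt_three (hne h))
  have hloop : ∀ i, m i i < 3 := fun i => by
    have h1 := hD5 i
    have h2 := single_le_sum (f := fun j => (if j = i then 2 else 1) * m i j)
      (fun _ _ => Nat.zero_le _) (mem_univ i)
    simp only [if_true] at h2
    omega
  have hll : ∀ i j, i ≠ j → m i i = 2 → m j j ≠ 2 := fun i j h h1 h2 =>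
    hG.not_double_loops (hne h) (h1 ▸ hle i i) (h2 ▸ hle j j)
  have hcomp : ∀ i j, i ≠ j → Compatible (m i i) (m j j) (m i j) := by
    intro i j h
    refine ⟨fun h1 => ?_, fun h1 => ?_, fun h1 h2 => ?_⟩
    · have := hG.mult_lt_two_of_loop (hne h) (h1.trans (hle i i))
      have := hle i j
      omega
    · have := hG.mult_lt_two_of_loop (hne h.symm) (h1.trans (hle j j))
      have := hle j i
      rw [hsymm]
      omega
    · have := hG.mult_eq_zero_of_loops (hne h) (h1.trans (hle i i)) (h2.trans (hle j j))
      have := hle i j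
      omega
  have h4 : ¬ ∀ i, ∑ j, (if j = i then 2 else 1) * m i j = 4 := by
    intro h4
    refine hG.not_four_regular (univ.image w) F ?_ ?_ ?_
    · rw [card_image_of_injective _ hw]
      decide
    · rintro ⟨e, t⟩ he
      obtain ⟨i, hi⟩ := hF e he t
      exact mem_image.2 ⟨i, mem_univ _, hi⟩
    · intro x hx
      obtain ⟨i, -, rfl⟩ := mem_image.1 hx
      rw [hD, h4]
  have hmat : m = multMatrix (m 0 0) (m 1 1) (m 2 2) (m 3 3) (m 0 1) (m 0 2) (m 0 3) (m 1 2)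
      (m 1 3) (m 2 3) := by
    funext i j
    have h10 := hsymm 1 0
    have h20 := hsymm 2 0
    have h30 := hsymm 3 0
    have h21 := hsymm 2 1
    have h31 := hsymm 3 1
    have h32 := hsymm 3 2
    fin_cases i <;> fin_cases j <;> first | rfl | assumption
  have e0 := hD5 0
  have e1 := hD5 1
  have e2 := hD5 2
  have e3 := hD5 3
  simp only [Fin.forall_fin_succ, Fin.sum_univ_four, Fin.isValue] at hsum e0 e1 e2 e3 h4
  simp [hsymm 1 0, hsymm 2 0, hsymm 3 0, hsymm 2 1, hsymm 3 1, hsymm 3 2] at hsum e0 e1 e2 e3 h4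
  have key : HasForbidden m := by
    rw [hmat]
    exact hasForbidden_of_card_eq_eight ⟨m 0 0, hloop 0⟩ ⟨m 1 1, hloop 1⟩
      (fun h => Fin.ne_of_val_ne (hll 0 1 (by decide) (congrArg Fin.val h)))
      ⟨m 2 2, hloop 2⟩
      (fun h => Fin.ne_of_val_ne (hll 0 2 (by decide) (congrArg Fin.val h)))
      (fun h => Fin.ne_of_val_ne (hll 1 2 (by decide) (congrArg Fin.val h)))
      ⟨m 3 3, hloop 3⟩
      (fun h => Fin.ne_of_val_ne (hll 0 3 (by decide) (congrArg Fin.val h)))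
      (fun h => Fin.ne_of_val_ne (hll 1 3 (by decide) (congrArg Fin.val h)))
      (fun h => Fin.ne_of_val_ne (hll 2 3 (by decide) (congrArg Fin.val h)))
      ⟨m 0 1, h3 0 1 (by decide)⟩ (hcomp 0 1 (by decide))
      ⟨m 0 2, h3 0 2 (by decide)⟩ (hcomp 0 2 (by decide))
      ⟨m 0 3, h3 0 3 (by decide)⟩ (hcomp 0 3 (by decide)) e0
      ⟨m 1 2, h3 1 2 (by decide)⟩ (hcomp 1 2 (by decide))
      ⟨m 1 3, h3 1 3 (by decide)⟩ (hcomp 1 3 (by decide)) e1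
      ⟨m 2 3, h3 2 3 (by decide)⟩ (hcomp 2 3 (by decide)) e2 e3
      (by simp only; omega) (by simp only; rintro ⟨g0, g1, g2, g3⟩; exact h4 g0 g1 g2 g3)
  obtain ⟨i, j, hij, k, hik, hjk, l, hil, hjl, hkl, h | h | h⟩ := key
  · exact hG.not_double_triangle (hne hij) (hne hik) (hne hjk) (h.1.trans (hle _ _))
      (h.2.2.trans (hle _ _)) (h.2.1.trans (hle _ _))
  · refine hG.not_double_path (hne hij) (hne hik) (hne hil) (hne hjk) (hne hjl) (hne hkl) ?_
      (h.2.1.trans (hle _ _)) (h.2.2.trans (hle _ _))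
    rw [mult_comm]
    exact h.1.trans (hle _ _)
  · have hσ : Function.Injective ![i, j, k, l] := by
      intro p q
      fin_cases p <;> fin_cases q <;> simp [hij, hik, hil, hjk, hjl, hkl, hij.symm, hik.symm,
        hil.symm, hjk.symm, hjl.symm, hkl.symm]
    exact hG.not_isDense (hw.comp hσ) (h.mono hle)

end

/-! ### Edge cuts and perfect matchings -/

section Cut

variable {V : Type*} {ι : Type u} [Fintype V] [DecidableEq V] [Fintype ι] [DecidableEq ι]
  {a : ι × Bool → V}

/-- The half-edges at `C` whose other halves are not at `C`. -/
def cut (a : ι × Bool → V) (C : Finset V) : Finset (ι × Bool) := {h | a h ∈ C ∧ a (flip h) ∉ C}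

/-- The edges with both ends in `C`. -/
def inner (a : ι × Bool → V) (C : Finset V) : Finset ι := {e | a (e, false) ∈ C ∧ a (e, true) ∈ C}

/-- The loops at vertices of `C`. -/
def loops (a : ι × Bool → V) (C : Finset V) : Finset ι :=
  {e | a (e, false) ∈ C ∧ a (e, true) = a (e, false)}

omit [Fintype V] [DecidableEq ι] in
lemma mem_cut {C : Finset V} {h : ι × Bool} : h ∈ cut a C ↔ a h ∈ C ∧ a (flip h) ∉ C := by
  simp [cut]

omit [Fintype V] [DecidableEq ι] in
lemma mem_inner {C : Finset V} {h : ι × Bool} : h.1 ∈ inner a C ↔ a h ∈ C ∧ a (flip h) ∈ C := by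
  obtain ⟨e, _ | _⟩ := h
  · simp [inner, flip]
  · simp [inner, flip, and_comm]

omit [Fintype V] [DecidableEq ι] in
lemma loops_mono {C D : Finset V} (h : C ⊆ D) : loops a C ⊆ loops a D := fun e he => by
  simp only [loops, mem_filter, mem_univ, true_and] at he ⊢
  exact ⟨h he.1, he.2⟩

omit [Fintype V] in
lemma card_cut_add (ha : ∀ x, deg a x = 5) (C : Finset V) :
    #(cut a C) + #(inner a C) * 2 = 5 * #C := by
  have : #(inner a C) * 2 = #{h : ι × Bool | h.1 ∈ inner a C} := by
    rw [← Fintype.card_bool, ← card_univ, ← card_product]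
    congr 1
    ext h
    simp
  rw [this, ← card_filter_mem ha, ← card_union_of_disjoint]
  · congr 1
    ext h
    simp only [mem_union, mem_cut, mem_filter, mem_univ, true_and, mem_inner]
    tauto
  · rw [disjoint_left]
    intro h h1 h2
    simp only [mem_cut, mem_filter, mem_univ, true_and, mem_inner] at h1 h2
    exact h1.2 h2.2

omit [Fintype V] in
lemma even_card_cut_iff (ha : ∀ x, deg a x = 5) (C : Finset V) : Even #(cut a C) ↔ Even #C := by
  have h1 : Even (#(cut a C) + #(inner a C) * 2) ↔ Even (5 * #C) := by rw [card_cut_add ha]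
  rw [Nat.even_add, Nat.even_mul, Nat.even_mul] at h1
  have : ¬ Even 5 := by decide
  have : Even 2 := by decide
  tauto

omit [Fintype V] in
lemma card_loops_of_card_eq_one (ha : ∀ x, deg a x = 5) {C : Finset V} (hC : #C = 1) :
    #(cut a C) + #(loops a C) * 2 = 5 := by
  have h1 := card_cut_add ha C
  obtain ⟨x, rfl⟩ := card_eq_one.1 hC
  have : inner a {x} = loops a {x} := by
    ext e
    simp only [inner, loops, mem_filter, mem_univ, true_and, mem_singleton]
    constructor
    · exact fun h => ⟨h.1, h.2.trans h.1.symm⟩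
    · exact fun h => ⟨h.1, h.2.trans h.1⟩
  rw [this, card_singleton] at h1
  omega

/-- If a single edge leaves `C` and there are at least two vertices outside `C`, then `C` has two
loops, as it consists of a single vertex: otherwise each of the two sides can be contracted, and the
two colorings can be put together after permuting the colors of one of them. -/
theorem IsMinimal.two_le_card_loops (hG : IsMinimal a) {C : Finset V} (hcut : #(cut a C) = 1)
    (hC : 2 ≤ #Cᶜ) : 2 ≤ #(loops a C) := by
  by_cases h1 : #C = 1
  · have := card_loops_of_card_eq_one hG.deg_eq h1
    omega
  exfalso
  have hCpos : 0 < #C := by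
    obtain ⟨h, hh⟩ := card_pos.1 (by omega : 0 < #(cut a C))
    exact card_pos.2 ⟨_, (mem_cut.1 hh).1⟩
  have hcut' : #(cut a Cᶜ) = 1 := by
    rw [← hcut]
    refine card_bij (fun h _ => flip h) (fun h hh => ?_) (fun h _ h' _ hh => ?_) fun h hh => ?_
    · simpa [mem_cut, and_comm] using hh
    · simpa using congrArg flip hh
    · exact ⟨flip h, by simpa [mem_cut, and_comm] using hh, flip_flip h⟩
  obtain ⟨c₁, hc₁, -⟩ := hG.exists_coloring_contract C (by omega) (cut a C)
    (fun h hh => (mem_cut.1 hh).1) (by omega) (even_card_cut_iff hG.deg_eq C)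
  obtain ⟨c₂, hc₂, -⟩ := hG.exists_coloring_contract Cᶜ hC (cut a Cᶜ)
    (fun h hh => (mem_cut.1 hh).1) (by omega) (even_card_cut_iff hG.deg_eq Cᶜ)
  obtain ⟨h₀, hh₀⟩ := card_eq_one.1 hcut
  -- `σ` makes the two colorings agree on the edge that leaves `C`
  let σ := Equiv.swap (c₂ h₀.1) (c₁ h₀.1)
  refine hG.not_colorable ⟨fun e => if e ∈ inner a C then σ (c₂ e) else c₁ e, fun x => ?_⟩
  by_cases hx : x ∈ C
  · refine ((hc₂ x (by simpa using hx)).comp_injective σ.injective).congr fun h hh => ?_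
    by_cases hi : h.1 ∈ inner a C
    · simp [hi]
    · have : h ∈ cut a C := by
        rw [mem_inner, hh] at hi
        exact mem_cut.2 ⟨hh ▸ hx, fun h' => hi ⟨hx, h'⟩⟩
      rw [hh₀, mem_singleton] at this
      subst this
      simp [hi, σ]
  · exact (hc₁ x hx).congr fun h hh => if_neg fun hi => hx (hh ▸ (mem_inner.1 hi).1)

end Cut

section Matching

variable {V : Type*} {ι : Type u} [Fintype V] [DecidableEq V] [Fintype ι] [DecidableEq ι]

/-- Tutte's theorem for the subgraph induced by a set `U` of vertices of even size: either it has a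
perfect matching `F`, or for some set `S` there are at least `|S| + 2` odd components of `U \ S`. -/
theorem exists_matching_or_components (a : ι × Bool → V) (U : Finset V) (hU : Even #U) :
    (∃ F ⊆ inner a U, ∀ x ∈ U, ∃ h₀, a h₀ = x ∧ h₀.1 ∈ F ∧ ∀ h, a h = x → h.1 ∈ F → h = h₀) ∨
    ∃ S ⊆ U, ∃ P : Finset (Finset V), #S + 2 ≤ #P ∧ (P : Set (Finset V)).PairwiseDisjoint id ∧
      ∀ D ∈ P, D ⊆ U ∧ Disjoint D S ∧ Odd #D ∧
        ∀ h, a h ∈ D → a (flip h) ∈ D ∨ a (flip h) ∈ S ∨ a (flip h) ∉ U := by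
  classical
  let G : SimpleGraph U :=
    { Adj := fun x y => x ≠ y ∧ ∃ h, a h = x ∧ a (flip h) = y
      symm := ⟨fun x y ⟨h1, h, h2, h3⟩ => ⟨h1.symm, flip h, h3, by simpa using h2⟩⟩
      loopless := ⟨fun x h => h.1 rfl⟩ }
  by_cases hM : ∃ M : G.Subgraph, M.IsPerfectMatching
  · left
    obtain ⟨M, hM⟩ := hM
    rw [SimpleGraph.Subgraph.isPerfectMatching_iff] at hM
    have hpick : ∀ z : M.edgeSet, ∃ e : ι,
        s(a (e, false), a (e, true)) = (z : Sym2 U).map Subtype.val := by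
      rintro ⟨z, hz⟩
      induction z with
      | _ x y =>
      obtain ⟨-, h, h1, h2⟩ := M.adj_sub hz
      exact ⟨h.1, by rw [ends_eq, h1, h2]; rfl⟩
    choose pick hpick using hpick
    refine ⟨univ.filter fun e => ∃ z, pick z = e, fun e he => ?_, fun x hx => ?_⟩
    · simp only [mem_filter, mem_univ, true_and] at he
      obtain ⟨⟨z, hz⟩, rfl⟩ := he
      have := hpick ⟨z, hz⟩
      induction z with
      | _ x y =>
      simp only [Sym2.map_mk, Sym2.eq_iff] at this
      simp only [inner, mem_filter, mem_univ, true_and]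
      rcases this with ⟨h1, h2⟩ | ⟨h1, h2⟩ <;> rw [h1, h2] <;>
        exact ⟨Subtype.prop _, Subtype.prop _⟩
    · obtain ⟨y, hy', huniq⟩ := hM ⟨x, hx⟩
      have hy : s(⟨x, hx⟩, y) ∈ M.edgeSet := hy'
      have hz := hpick ⟨s(⟨x, hx⟩, y), hy⟩
      obtain ⟨t, h1, h2⟩ := exists_of_ends_eq hz
      refine ⟨_, h1, mem_filter.2 ⟨mem_univ _, _, rfl⟩, fun h hh hF => ?_⟩
      simp only [mem_filter, mem_univ, true_and] at hF
      obtain ⟨⟨z, hz'⟩, hzh⟩ := hF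
      have h3 := hpick ⟨z, hz'⟩
      rw [hzh, ends_eq, hh] at h3
      -- the edge of `h` also comes from the matching edge at `x`
      have h4 : z = s(⟨x, hx⟩, y) := by
        have : (⟨x, hx⟩ : U) ∈ z := by
          have h5 : x ∈ z.map Subtype.val := h3 ▸ Sym2.mem_mk_left _ _
          obtain ⟨v, hv, rfl⟩ := Sym2.mem_map.1 h5
          exact hv
        obtain ⟨v, rfl⟩ := this
        rw [huniq v hz']
      subst h4
      rcases eq_or_eq_flip (k := h) (h := (pick ⟨_, hz'⟩, t)) hzh.symm with h5 | h5
      · exact h5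
      · exfalso
        rw [h5] at hh
        have h6 : (y : V) = x := h2.symm.trans hh
        exact (M.adj_sub hy').1 (Subtype.ext h6.symm)
  · right
    rw [SimpleGraph.tutte] at hM
    push Not at hM
    obtain ⟨u, hu⟩ := hM
    set G' := ((⊤ : G.Subgraph).deleteVerts u).coe with hG'
    have hpar := G'.odd_ncard_oddComponents
    have hu' : u.ncard < G'.oddComponents.ncard := hu
    let S : Finset V := univ.filter fun x => ∃ hx : x ∈ U, (⟨x, hx⟩ : U) ∈ u
    have hS : #S = u.ncard := by
      rw [Set.ncard_eq_toFinset_card']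
      symm
      refine card_bij (fun x _ => (x : V)) (fun x hx => ?_) (fun _ _ _ _ h => Subtype.ext h)
        fun x hx => ?_
      · simp only [S, mem_filter, mem_univ, true_and]
        exact ⟨x.2, by simpa using hx⟩
      · obtain ⟨h1, h2⟩ := (mem_filter.1 hx).2
        exact ⟨⟨x, h1⟩, by simpa using h2, rfl⟩
    have hverts : Nat.card ((⊤ : G.Subgraph).deleteVerts u).verts + #S = #U := by
      have h1 : ((⊤ : G.Subgraph).deleteVerts u).verts = uᶜ := by
        ext x
        simp
      rw [h1, hS, Nat.card_coe_set_eq, add_comm, Set.ncard_add_ncard_compl]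
      simp
    let f : G'.ConnectedComponent → Finset V :=
      fun c => univ.filter fun x => ∃ y ∈ c.supp, (y : U) = x
    have hf : ∀ c, #(f c) = c.supp.ncard := by
      intro c
      rw [Set.ncard_eq_toFinset_card']
      symm
      refine card_bij (fun y _ => ((y : U) : V)) (fun y hy => ?_)
        (fun _ _ _ _ h => Subtype.ext (Subtype.ext h)) fun x hx => ?_
      · simp only [f, mem_filter, mem_univ, true_and]
        exact ⟨y, by simpa using hy, rfl⟩
      · obtain ⟨y, h1, h2⟩ := (mem_filter.1 hx).2
        exact ⟨y, by simpa using h1, h2⟩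
    have hdisj : ∀ c c', c ≠ c' → Disjoint (f c) (f c') := by
      intro c c' hcc
      rw [disjoint_left]
      intro x h1 h2
      obtain ⟨y, h3, h4⟩ := (mem_filter.1 h1).2
      obtain ⟨y', h5, h6⟩ := (mem_filter.1 h2).2
      obtain rfl : y = y' := Subtype.ext (Subtype.ext (h4.trans h6.symm))
      exact hcc (h3.symm.trans h5)
    have hinj : Set.InjOn f (G'.oddComponents : Set G'.ConnectedComponent) := by
      intro c hc c' _ hcc
      by_contra hne
      have h1 := hdisj c c' hne
      rw [← hcc, disjoint_self_iff_empty] at h1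
      have h2 : Odd c.supp.ncard := hc
      rw [← hf, h1] at h2
      simp at h2
    refine ⟨S, fun x hx => ?_, G'.oddComponents.toFinset.image f, ?_, ?_, ?_⟩
    · obtain ⟨h, -⟩ := (mem_filter.1 hx).2
      exact h
    · rw [card_image_of_injOn (by simpa using hinj), ← Set.ncard_eq_toFinset_card', hS]
      rw [← hS] at hu' ⊢
      -- the number of odd components has the parity of `U \ S`
      have h1 : Even G'.oddComponents.ncard ↔ Even #S := by
        have h2 : Even (Nat.card ((⊤ : G.Subgraph).deleteVerts u).verts + #S) := by rwa [hverts]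
        rw [Nat.even_add] at h2
        rw [← h2, ← Nat.not_odd_iff_even, ← Nat.not_odd_iff_even, hpar]
      by_contra h2
      have h3 : G'.oddComponents.ncard = #S + 1 := by omega
      rw [h3, Nat.even_add_one] at h1
      tauto
    · intro D hD D' hD' hne
      simp only [coe_image, Set.mem_image] at hD hD'
      obtain ⟨c, -, rfl⟩ := hD
      obtain ⟨c', -, rfl⟩ := hD'
      exact hdisj c c' fun h => hne (by rw [h])
    · intro D hD
      obtain ⟨c, hc, rfl⟩ := mem_image.1 hD
      refine ⟨fun x hx => ?_, ?_, ?_, fun h hh => ?_⟩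
      · obtain ⟨y, -, rfl⟩ := (mem_filter.1 hx).2
        exact y.1.2
      · rw [disjoint_left]
        intro x h1 h2
        obtain ⟨y, h3, rfl⟩ := (mem_filter.1 h1).2
        obtain ⟨h4, h5⟩ := (mem_filter.1 h2).2
        exact y.2.2 h5
      · rw [hf]
        simpa using hc
      · obtain ⟨y, h1, h2⟩ := (mem_filter.1 hh).2
        by_cases hU' : a (flip h) ∈ U
        · by_cases hSS : a (flip h) ∈ S
          · exact .inr (.inl hSS)
          · left
            have h3 : (⟨a (flip h), hU'⟩ : U) ∉ u := fun h3 =>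
              hSS (mem_filter.2 ⟨mem_univ _, hU', h3⟩)
            by_cases hne : a (flip h) = a h
            · rwa [hne]
            refine mem_filter.2 ⟨mem_univ _, ⟨⟨a (flip h), hU'⟩, by simpa using h3⟩, ?_, rfl⟩
            rw [← (show G'.connectedComponentMk y = c from h1)]
            refine SimpleGraph.ConnectedComponent.sound (SimpleGraph.Adj.reachable ?_)
            rw [hG', SimpleGraph.Subgraph.coe_adj, SimpleGraph.Subgraph.deleteVerts_adj]
            refine ⟨trivial, h3, trivial, y.2.2, ?_⟩
            refine ⟨fun h4 => hne ?_, flip h, rfl, by rw [flip_flip, h2]⟩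
            rw [← h2, ← h4]
        · exact .inr (.inr hU')

end Matching

/-! ### Counting loops -/

section Loops

variable {V : Type*} {ι : Type u} [Fintype V] [DecidableEq V] [Fintype ι] [DecidableEq ι]
  {a : ι × Bool → V}

omit [Fintype V] [DecidableEq ι] in
lemma card_filter_flip_mem (ha : ∀ x, deg a x = 5) (S : Finset V) :
    #{h | a (flip h) ∈ S} = 5 * #S := by
  rw [← card_filter_mem ha S]
  exact card_bij (fun h _ => flip h) (fun h hh => by simpa using hh)
    (fun h _ h' _ hh => by simpa using congrArg flip hh)
    fun h hh => ⟨flip h, by simpa using hh, flip_flip h⟩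

/-- A set of vertices with exactly three outgoing edges contains a loop. Otherwise it is contracted;
one of the three edges, with end `w`, gets the exceptional color, and a perfect matching of the set
without `w` completes the coloring. Such a matching exists by Tutte's theorem, because odd
components with at most three outgoing edges would contain loops, by induction. -/
theorem IsMinimal.one_le_card_loops (hG : IsMinimal a) (C : Finset V) (hcut : #(cut a C) = 3) :
    1 ≤ #(loops a C) := by
  induction hn : #C using Nat.strong_induction_on generalizing C with
  | _ n ih =>
  subst hn
  by_contra hloop
  have hloop0 : #(loops a C) = 0 := by omega
  have hCodd : ¬ Even #C := by
    rw [← even_card_cut_iff hG.deg_eq, hcut]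
    decide
  have hC : 2 ≤ #C := by
    by_contra h
    have h1 : #C = 1 := by
      rcases Nat.eq_zero_or_pos #C with h0 | h0
      · rw [h0] at hCodd
        exact absurd (by decide) hCodd
      · omega
    have := card_loops_of_card_eq_one hG.deg_eq h1
    omega
  obtain ⟨c, hc, hX⟩ := hG.exists_coloring_contract C hC (cut a C)
    (fun h hh => (mem_cut.1 hh).1) (by omega) (even_card_cut_iff hG.deg_eq C)
  obtain ⟨i, h₀, hh₀, hi, hrest⟩ := hX (by rw [hcut]; decide)
  have hw := (mem_cut.1 hh₀).1
  have hinner : ∀ {x h}, x ∈ C → a h = x → h.1 ∉ inner a C → h ∈ cut a C := by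
    rintro x h hx rfl hin
    exact mem_cut.2 ⟨hx, fun h' => hin (mem_inner.2 ⟨hx, h'⟩)⟩
  have hU : Even #(C.erase (a h₀)) := by
    obtain ⟨k, hk⟩ := Nat.not_even_iff_odd.1 hCodd
    rw [card_erase_of_mem hw]
    exact ⟨k, by omega⟩
  rcases exists_matching_or_components a _ hU with ⟨F, hFi, hF⟩ | ⟨S, hSU, P, hP, hdisj, hD⟩
  · have hFi' : ∀ {h : ι × Bool}, h.1 ∈ F → a h ∈ C ∧ a h ≠ a h₀ ∧ a (flip h) ∈ C := by
      intro h hh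
      have h1 := mem_inner.1 (hFi hh)
      rw [mem_erase, mem_erase] at h1
      exact ⟨h1.1.2, h1.1.1, h1.2.2⟩
    refine hG.not_colorable
      ⟨fun e => if e ∈ inner a C then if e ∈ F then c h₀.1 else i else c e, fun x => ?_⟩
    by_cases hx : x ∈ C
    · by_cases hxw : x = a h₀
      · subst hxw
        have hin : h₀.1 ∉ inner a C := fun h => (mem_cut.1 hh₀).2 (mem_inner.1 h).2
        refine ⟨i, h₀, rfl, by simpa [hin] using hi, fun h hh hne => ?_⟩
        by_cases hin' : h.1 ∈ inner a C
        · have : h.1 ∉ F := fun hF' => (hFi' hF').2.1 hh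
          simp [hin', this]
        · simpa [hin'] using hrest h (hinner hx hh hin') hne
      · obtain ⟨h₁, h1, h2, h3⟩ := hF x (mem_erase.2 ⟨hxw, hx⟩)
        have hin : h₁.1 ∈ inner a C := mem_inner.2 ⟨(hFi' h2).1, (hFi' h2).2.2⟩
        refine ⟨i, h₁, h1, by simpa [hin, h2] using hi, fun h hh hne => ?_⟩
        by_cases hin' : h.1 ∈ inner a C
        · have : h.1 ∉ F := fun hF' => hne (h3 h hh hF')
          simp [hin', this]
        · have hne' : h ≠ h₀ := by
            rintro rfl
            exact hxw hh.symm
          simpa [hin'] using hrest h (hinner hx hh hin') hne'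
    · exact (hc x hx).congr fun h hh => if_neg fun hi => hx (hh ▸ (mem_inner.1 hi).1)
  · have hDC : ∀ D ∈ P, D ⊆ C.erase (a h₀) := fun D h => (hD D h).1
    -- every odd component has at least five outgoing edges
    have h5 : ∀ D ∈ P, 5 ≤ #(cut a D) := by
      intro D hDP
      have hDC' := (hDC D hDP).trans (erase_subset _ _)
      have h0 : #(loops a D) = 0 := by
        have := card_le_card (loops_mono (a := a) hDC')
        omega
      have hodd : ¬ Even #(cut a D) := by
        rw [even_card_cut_iff hG.deg_eq, Nat.not_even_iff_odd]
        exact (hD D hDP).2.2.1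
      have h1 : #(cut a D) ≠ 1 := by
        intro h1
        have : 2 ≤ #(loops a D) := hG.two_le_card_loops h1 <| by
          refine one_lt_card.2 ⟨a h₀, ?_, a (flip h₀), ?_, ?_⟩
          · exact mem_compl.2 fun h => (mem_erase.1 (hDC D hDP h)).1 rfl
          · exact mem_compl.2 fun h => (mem_cut.1 hh₀).2 (hDC' h)
          · exact fun h => (mem_cut.1 hh₀).2 (h ▸ hw)
        omega
      have h3 : #(cut a D) ≠ 3 := by
        intro h3
        have := ih #D ((card_le_card (hDC D hDP)).trans_lt (card_erase_lt_of_mem hw)) D h3 rfl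
        omega
      by_contra h
      have : #(cut a D) < 5 := by omega
      interval_cases h' : #(cut a D)
      exacts [hodd (by decide), h1 rfl, hodd (by decide), h3 rfl, hodd (by decide)]
    have hsub : P.biUnion (cut a) ⊆
        (univ.filter fun h => a (flip h) ∈ insert (a h₀) S) ∪ cut a C := by
      intro h hh
      obtain ⟨D, hDP, hh⟩ := mem_biUnion.1 hh
      obtain ⟨h1, h2⟩ := mem_cut.1 hh
      have hC' := (mem_erase.1 (hDC D hDP h1)).2
      rw [mem_union, mem_filter, mem_insert, mem_cut]
      rcases (hD D hDP).2.2.2 h h1 with h3 | h3 | h3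
      · exact absurd h3 h2
      · exact .inl ⟨mem_univ _, .inr h3⟩
      · rw [mem_erase, not_and_or, not_not] at h3
        rcases h3 with h3 | h3
        exacts [.inl ⟨mem_univ _, .inl h3⟩, .inr ⟨hC', h3⟩]
    have h6 := (card_le_card hsub).trans (card_union_le _ _)
    rw [card_filter_flip_mem hG.deg_eq, hcut, card_biUnion] at h6
    · have h7 := card_insert_le (a h₀) S
      have h8 := sum_le_sum h5
      rw [sum_const, smul_eq_mul] at h8
      omega
    · intro D hDP D' hDP' hne
      have := hdisj hDP hDP' hne
      rw [Function.onFun, id, id, disjoint_left] at this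
      exact disjoint_left.2 fun h h1 h2 => this (mem_cut.1 h1).1 (mem_cut.1 h2).1

/-- There are at least five loops. There is no perfect matching, so by Tutte's theorem there is a
set `S` of vertices whose removal leaves at least `|S| + 2` odd components. Such a component with
one outgoing edge has at least two loops, one with three outgoing edges has at least one, so that
the number of outgoing edges plus twice the number of loops is at least `5`. -/
theorem IsMinimal.five_le_card_loops (hG : IsMinimal a) : 5 ≤ #(loops a univ) := by
  have hV : Even #(univ : Finset V) := by
    rw [← even_card_cut_iff hG.deg_eq]
    simp [cut]
  rcases exists_matching_or_components a _ hV with ⟨F, -, hF⟩ | ⟨S, -, P, hP, hdisj, hD⟩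
  · exfalso
    refine hG.not_colorable ⟨fun e => if e ∈ F then 1 else 0, fun x => ?_⟩
    obtain ⟨h₀, h1, h2, h3⟩ := hF x (mem_univ x)
    exact ⟨0, h₀, h1, by simp [h2], fun h hh hne => if_neg fun hF' => hne (h3 h hh hF')⟩
  have hcutS : ∀ D ∈ P, ∀ h ∈ cut a D, a (flip h) ∈ S := by
    intro D hDP h hh
    obtain ⟨h1, h2⟩ := mem_cut.1 hh
    rcases (hD D hDP).2.2.2 h h1 with h3 | h3 | h3
    exacts [absurd h3 h2, h3, absurd (mem_univ _) h3]
  have h5 : ∀ D ∈ P, 5 ≤ #(cut a D) + 2 * #(loops a D) := by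
    intro D hDP
    have hodd : ¬ Even #(cut a D) := by
      rw [even_card_cut_iff hG.deg_eq, Nat.not_even_iff_odd]
      exact (hD D hDP).2.2.1
    have h1 : #(cut a D) = 1 → 2 ≤ #(loops a D) := by
      intro h1
      refine hG.two_le_card_loops h1 ?_
      -- the complement of `D` contains another component and a vertex of `S`
      obtain ⟨D', hDP', hne⟩ := exists_mem_ne (by omega : 1 < #P) D
      obtain ⟨x, hx⟩ := card_pos.1 (hD D' hDP').2.2.1.pos
      obtain ⟨h, hh⟩ := card_pos.1 (by omega : 0 < #(cut a D))
      have hS := hcutS D hDP h hh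
      refine one_lt_card.2 ⟨x, ?_, a (flip h), mem_compl.2 (mem_cut.1 hh).2, ?_⟩
      · exact mem_compl.2 fun h => disjoint_left.1 (hdisj hDP' hDP hne) hx h
      · rintro rfl
        exact disjoint_left.1 (hD D' hDP').2.1 hx hS
    have h3 : #(cut a D) = 3 → 1 ≤ #(loops a D) := hG.one_le_card_loops D
    by_contra h
    have : #(cut a D) < 5 := by omega
    interval_cases h' : #(cut a D)
    · exact hodd (by decide)
    · have := h1 rfl
      omega
    · exact hodd (by decide)
    · have := h3 rfl
      omega
    · exact hodd (by decide)
  have hdisj' : ∀ D ∈ P, ∀ D' ∈ P, D ≠ D' → Disjoint (cut a D) (cut a D') ∧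
      Disjoint (loops a D) (loops a D') := by
    intro D hDP D' hDP' hne
    have := hdisj hDP hDP' hne
    rw [Function.onFun, id, id, disjoint_left] at this
    refine ⟨disjoint_left.2 fun h h1 h2 => this (mem_cut.1 h1).1 (mem_cut.1 h2).1,
      disjoint_left.2 fun e h1 h2 => ?_⟩
    simp only [loops, mem_filter, mem_univ, true_and] at h1 h2
    exact this h1.1 h2.1
  have h6 : ∑ D ∈ P, #(cut a D) ≤ 5 * #S := by
    rw [← card_biUnion fun D h D' h' hne => (hdisj' D h D' h' hne).1,
      ← card_filter_flip_mem hG.deg_eq]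
    refine card_le_card fun h hh => ?_
    obtain ⟨D, hDP, hh⟩ := mem_biUnion.1 hh
    exact mem_filter.2 ⟨mem_univ _, hcutS D hDP h hh⟩
  have h7 : ∑ D ∈ P, #(loops a D) ≤ #(loops a univ) := by
    rw [← card_biUnion fun D h D' h' hne => (hdisj' D h D' h' hne).2]
    refine card_le_card fun e he => ?_
    obtain ⟨D, -, he⟩ := mem_biUnion.1 he
    exact loops_mono (subset_univ D) he
  have h8 := sum_le_sum h5
  rw [sum_const, smul_eq_mul, sum_add_distrib, ← mul_sum] at h8
  omega

end Loops

/-! ### Pseudographs as half-edge maps -/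

lemma goodAt_iff {V H κ : Type*} [Fintype H] [DecidableEq V] [DecidableEq κ] {a : H → V} {x : V}
    (hx : deg a x = 5) (c : H → κ) : GoodAt a c x ↔
      ∃ i j, i ≠ j ∧ #{h | a h = x ∧ c h = i} = 4 ∧ #{h | a h = x ∧ c h = j} = 1 := by
  classical
  constructor
  · rintro ⟨i, h₀, h1, h2, h3⟩
    have e1 : univ.filter (fun h => a h = x ∧ c h = i) =
        (univ.filter fun h => a h = x).erase h₀ := by
      ext h
      simp only [mem_filter, mem_univ, true_and, mem_erase]
      constructor
      · rintro ⟨g1, g2⟩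
        refine ⟨?_, g1⟩
        rintro rfl
        exact h2 g2
      · exact fun ⟨g1, g2⟩ => ⟨g2, h3 h g2 g1⟩
    have e2 : univ.filter (fun h => a h = x ∧ c h = c h₀) = {h₀} := by
      ext h
      simp only [mem_filter, mem_univ, true_and, mem_singleton]
      constructor
      · rintro ⟨g1, g2⟩
        by_contra hne
        exact h2 (g2.symm.trans (h3 h g1 hne))
      · rintro rfl
        exact ⟨h1, rfl⟩
    refine ⟨i, c h₀, h2.symm, ?_, ?_⟩
    · rw [e1, card_erase_of_mem (by simpa using h1), ← deg, hx]
    · rw [e2, card_singleton]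
  · rintro ⟨i, j, hij, h4, h1⟩
    obtain ⟨h₀, hh₀⟩ := card_eq_one.1 h1
    have hm : ∀ h, a h = x ∧ c h = j ↔ h = h₀ := fun h => by
      simpa using congrArg (h ∈ ·) hh₀
    obtain ⟨g1, g2⟩ := (hm h₀).2 rfl
    refine ⟨i, h₀, g1, by rw [g2]; exact hij.symm, fun h hh hne => ?_⟩
    have hdis : Disjoint (univ.filter fun h => a h = x ∧ c h = i)
        (univ.filter fun h => a h = x ∧ c h = j) := by
      rw [disjoint_left]
      intro h h1 h2
      simp only [mem_filter, mem_univ, true_and] at h1 h2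
      exact hij (h1.2.symm.trans h2.2)
    have hall := eq_of_subset_of_card_le (s := (univ.filter fun h => a h = x ∧ c h = i) ∪
        univ.filter fun h => a h = x ∧ c h = j) (t := univ.filter fun h => a h = x)
      (fun h hh => by
        simp only [mem_union, mem_filter, mem_univ, true_and] at hh ⊢
        rcases hh with hh | hh <;> exact hh.1)
      (by rw [card_union_of_disjoint hdis, h4, h1, ← deg, hx])
    have : h ∈ univ.filter fun h => a h = x := by simpa using hh
    rw [← hall] at this
    simp only [mem_union, mem_filter, mem_univ, true_and] at this
    rcases this with h5 | h5
    exacts [h5.2, absurd ((hm h).1 h5) hne]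

/-- The half-edge map `a` describes the graph `G`, whose vertices and edges are parametrized by `φ`
and `ε`. -/
structure Presents {α β V ι : Type*} (G : Graph α β) (φ : V → α) (ε : ι → β) (a : ι × Bool → V) :
    Prop where
  vertex_injective : φ.Injective
  edge_injective : ε.Injective
  range_vertex : Set.range φ = V(G)
  range_edge : Set.range ε = E(G)
  isLink : ∀ e, G.IsLink (ε e) (φ (a (e, false))) (φ (a (e, true)))

lemma exists_presents {α β : Type*} (G : Graph α β) :
    ∃ a : E(G) × Bool → V(G), Presents G Subtype.val Subtype.val a := by
  have : ∀ e : E(G), ∃ x y : V(G), G.IsLink e x y := by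
    rintro ⟨e, he⟩
    obtain ⟨x, y, h⟩ := G.exists_isLink_of_mem_edgeSet he
    exact ⟨⟨x, h.left_mem⟩, ⟨y, h.right_mem⟩, h⟩
  choose s t h using this
  exact ⟨fun h => if h.2 then t h.1 else s h.1, Subtype.val_injective, Subtype.val_injective,
    Subtype.range_val, Subtype.range_val, fun e => by simpa using h e⟩

/-- The graph described by a half-edge map. -/
def toGraph {V ι : Type*} (a : ι × Bool → V) : Graph V ι where
  vertexSet := Set.univ
  IsLink e x y := s(a (e, false), a (e, true)) = s(x, y)
  isLink_symm := fun e _ => ⟨fun x y h => h.trans Sym2.eq_swap⟩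
  eq_or_eq_of_isLink_of_isLink := fun e x y v w h h' => by
    have := Sym2.eq_iff.1 (h.symm.trans h')
    tauto
  left_mem_of_isLink := fun _ _ _ _ => trivial

lemma presents_toGraph {V ι V' ι' : Type*} (a : ι × Bool → V) (φ : V ≃ V') (ε : ι ≃ ι') :
    Presents (toGraph fun h : ι' × Bool => φ (a (ε.symm h.1, h.2))) φ ε a := by
  refine ⟨φ.injective, ε.injective, φ.surjective.range_eq, ?_, fun e => ?_⟩
  · rw [ε.surjective.range_eq, eq_comm, Set.eq_univ_iff_forall]
    exact fun e => ⟨_, _, rfl⟩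
  · simp [toGraph]

section Presents

variable {α β V ι : Type*} [Fintype V] [DecidableEq V] [Fintype ι] [DecidableEq ι]
  {G : Graph α β} {φ : V → α} {ε : ι → β} {a : ι × Bool → V}

omit [Fintype V] [DecidableEq V] [Fintype ι] [DecidableEq ι] in
lemma Presents.isLink_iff (hP : Presents G φ ε a) {e : ι} {x y : V} :
    G.IsLink (ε e) (φ x) (φ y) ↔ s(a (e, false), a (e, true)) = s(x, y) := by
  rw [(hP.isLink e).isLink_iff_sym2_eq]
  simpa using (Sym2.map.injective hP.vertex_injective).eq_iff (a := s(a (e, false), a (e, true)))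
    (b := s(x, y))

omit [Fintype V] [DecidableEq V] [Fintype ι] [DecidableEq ι] in
lemma Presents.isLoopAt_iff (hP : Presents G φ ε a) {e : ι} {x : V} :
    G.IsLoopAt (ε e) (φ x) ↔ a (e, false) = x ∧ a (e, true) = x := by
  rw [Graph.IsLoopAt, hP.isLink_iff, Sym2.eq_iff]
  tauto

omit [Fintype V] [DecidableEq V] [Fintype ι] [DecidableEq ι] in
lemma Presents.inc_iff (hP : Presents G φ ε a) {e : ι} {x : V} :
    G.Inc (ε e) (φ x) ↔ a (e, false) = x ∨ a (e, true) = x := by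
  constructor
  · intro h
    rcases h.eq_or_eq_of_isLink (hP.isLink e) with h | h
    exacts [.inl (hP.vertex_injective h.symm), .inr (hP.vertex_injective h.symm)]
  · rintro (rfl | rfl)
    exacts [(hP.isLink e).inc_left, (hP.isLink e).inc_right]

omit [Fintype V] [DecidableEq V] [DecidableEq ι] in
/-- Counting edges of `G` by counting in `ι`. -/
lemma Presents.ncard_edges (hP : Presents G φ ε a) {p : β → Prop} [DecidablePred fun e => p (ε e)]
    (hp : ∀ e, p e → e ∈ E(G)) : {e | p e}.ncard = #{e : ι | p (ε e)} := by
  rw [← Set.ncard_coe_finset, ← Set.ncard_image_of_injective _ hP.edge_injective]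
  congr 1
  ext e
  simp only [Set.mem_ofPred_eq, coe_filter, mem_univ, true_and, Set.mem_image]
  constructor
  · intro h
    obtain ⟨i, rfl⟩ : e ∈ Set.range ε := hP.range_edge ▸ hp e h
    exact ⟨i, h, rfl⟩
  · rintro ⟨i, h, rfl⟩
    exact h

omit [Fintype V] in
lemma Presents.degreeIn_eq (hP : Presents G φ ε a) (F : Set β) [DecidablePred fun e => ε e ∈ F]
    (x : V) : G.degreeIn F (φ x) = #{h | a h = x ∧ ε h.1 ∈ F} := by
  classical
  have hsum : #{h | a h = x ∧ ε h.1 ∈ F} =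
      #{e : ι | ε e ∈ F ∧ a (e, false) = x} + #{e : ι | ε e ∈ F ∧ a (e, true) = x} := by
    rw [card_filter, Fintype.sum_prod_type, card_filter, card_filter, ← sum_add_distrib]
    refine sum_congr rfl fun e _ => ?_
    rw [Fintype.sum_bool, add_comm]
    simp only [and_comm]
  rw [← card_union_add_card_inter, ← filter_or, ← filter_and] at hsum
  rw [hsum, Graph.degreeIn, hP.ncard_edges fun e he => he.2.edge_mem,
    hP.ncard_edges fun e he => he.2.edge_mem]
  simp only [hP.inc_iff, hP.isLoopAt_iff]
  congr 2 <;> ext e <;> simp only [mem_filter] <;> tauto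

omit [Fintype V] [DecidableEq ι] in
lemma Presents.multiplicity_eq (hP : Presents G φ ε a) (x y : V) :
    G.multiplicity (φ x) (φ y) = mult a x y := by
  classical
  rw [Graph.multiplicity, hP.ncard_edges fun e he => he.edge_mem, mult]
  simp only [hP.isLink_iff]

omit [Fintype V] in
lemma Presents.degree_eq (hP : Presents G φ ε a) (x : V) : G.degree (φ x) = deg a x := by
  classical
  rw [Graph.degree, hP.degreeIn_eq, deg]
  congr 1
  ext h
  have : ε h.1 ∈ E(G) := hP.range_edge ▸ Set.mem_range_self _
  simp [this]

omit [Fintype V] [DecidableEq ι] in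
lemma Presents.adj_iff (hP : Presents G φ ε a) {x y : V} :
    G.Adj (φ x) (φ y) ↔ 1 ≤ mult a x y := by
  rw [mult, Nat.one_le_iff_ne_zero, Nat.ne_zero_iff_zero_lt, card_pos]
  constructor
  · rintro ⟨e, he⟩
    obtain ⟨i, rfl⟩ : e ∈ Set.range ε := hP.range_edge ▸ he.edge_mem
    exact ⟨i, mem_filter.2 ⟨mem_univ _, hP.isLink_iff.1 he⟩⟩
  · rintro ⟨i, hi⟩
    exact ⟨ε i, hP.isLink_iff.2 (mem_filter.1 hi).2⟩

omit [Fintype V] [DecidableEq ι] in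
lemma Presents.hasLoop_iff (hP : Presents G φ ε a) {x : V} :
    G.HasLoop (φ x) ↔ 1 ≤ mult a x x :=
  hP.adj_iff (x := x) (y := x)

omit [Fintype V] [Fintype ι] [DecidableEq V] [DecidableEq ι] in
lemma Presents.exists_of_mem (hP : Presents G φ ε a) {x : α} (hx : x ∈ V(G)) : ∃ y, φ y = x := by
  rwa [← hP.range_vertex] at hx

omit [Fintype V] [Fintype ι] [DecidableEq V] [DecidableEq ι] in
lemma Presents.mem (hP : Presents G φ ε a) (x : V) : φ x ∈ V(G) :=
  hP.range_vertex ▸ Set.mem_range_self x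

omit [Fintype V] in
/-- Colorings of `G` in terms of half-edges. -/
lemma Presents.isEdgeColoring_iff (hP : Presents G φ ε a) (h5 : ∀ x, deg a x = 5) (c : β → ℕ) :
    G.IsEdgeColoring 4 1 c ↔ ∀ x, GoodAt a (fun h => c (ε h.1)) x := by
  classical
  have hx : ∀ x, (∃ i j : ℕ, i ≠ j ∧ G.degreeIn {e | c e = i} (φ x) = 4 ∧
      G.degreeIn {e | c e = j} (φ x) = 1) ↔ GoodAt a (fun h => c (ε h.1)) x := by
    intro x
    rw [goodAt_iff (h5 x)]
    simp only [hP.degreeIn_eq, Set.mem_ofPred_eq]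
  constructor
  · exact fun h x => (hx x).1 (h _ (hP.mem x))
  · intro h x hxV
    obtain ⟨y, rfl⟩ := hP.exists_of_mem hxV
    exact (hx y).2 (h y)

omit [DecidableEq V] [Fintype ι] [DecidableEq ι] in
lemma Presents.ncard_vertexSet (hP : Presents G φ ε a) : V(G).ncard = Fintype.card V := by
  rw [← hP.range_vertex, ← Set.image_univ, Set.ncard_image_of_injective _ hP.vertex_injective,
    Set.ncard_univ, Nat.card_eq_fintype_card]

end Presents

/-- The half-edge form of a vertex-minimal uncolorable graph is minimal. -/
lemma Presents.isMinimal {α β V ι : Type*} [Fintype V] [DecidableEq V] [Fintype ι] [DecidableEq ι]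
    {G : Graph α β} {φ : V → α} {ε : ι → β} {a : ι × Bool → V} (hP : Presents G φ ε a)
    (hG : G.IsVertexMinimalUncolorable) : IsMinimal a := by
  have h5 : ∀ x, deg a x = 5 := fun x => by
    rw [← hP.degree_eq]
    exact hG.regular _ (hP.mem x)
  refine ⟨h5, ?_, ?_⟩
  · rintro ⟨c, hc⟩
    refine hG.not_hasEdgeColoring ⟨Function.extend ε c 0, ?_⟩
    rw [hP.isEdgeColoring_iff h5]
    simpa only [hP.edge_injective.extend_apply] using hc
  · intro N M b hN hb
    -- the minimality of `G` concerns graphs with vertices and edges in the universes of `G`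
    have hP' := presents_toGraph b (Equiv.ulift.{_, 0}.symm : Fin N ≃ ULift (Fin N))
      (Equiv.ulift.{_, 0}.symm : Fin M ≃ ULift (Fin M))
    obtain ⟨c, hc⟩ := hG.minimal _ _ _ ⟨Set.toFinite _, Set.toFinite _⟩
      (fun x hx => by
        obtain ⟨y, rfl⟩ := hP'.exists_of_mem hx
        rw [hP'.degree_eq, hb])
      (by rw [hP'.ncard_vertexSet, hP.ncard_vertexSet, Fintype.card_fin]; exact hN)
    exact ⟨fun i => c (Equiv.ulift.symm i), (hP'.isEdgeColoring_iff hb c).1 hc⟩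

lemma two_mul_mult_self_le {V ι : Type*} [DecidableEq V] [Fintype ι] {a : ι × Bool → V} (x : V) :
    2 * mult a x x ≤ deg a x := by
  rw [mult, mul_comm, ← Fintype.card_bool, ← card_univ, ← card_product]
  refine card_le_card fun h hh => ?_
  obtain ⟨e, t⟩ := h
  simp only [mem_product, mem_filter, mem_univ, true_and, and_true, Sym2.eq_iff, or_self] at hh
  cases t
  exacts [mem_filter.2 ⟨mem_univ _, hh.1⟩, mem_filter.2 ⟨mem_univ _, hh.2⟩]

end HalfEdge

open HalfEdge in
theorem theorem3p3 {α : Type*} {β : Type*} (G : Graph α β)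
    (hG : G.IsVertexMinimalUncolorable) :
    -- no 4-regular subgraph with at least two vertices
    (∀ H : Graph α β, H ≤ G → 2 ≤ V(H).ncard → ¬ H.IsRegular 4) ∧
    -- no three parallel edges
    (∀ x y : α, G.multiplicity x y < 3) ∧
    -- no path of length three consisting of double edges
    (¬ ∃ p : Fin 4 → α, Function.Injective p ∧
      G.DoubleEdge (p 0) (p 1) ∧ G.DoubleEdge (p 1) (p 2) ∧ G.DoubleEdge (p 2) (p 3)) ∧
    -- no vertex with a loop is incident to a double edge
    (∀ x y : α, G.HasLoop x → ¬ G.DoubleEdge x y) ∧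
    -- no two vertices with loops are adjacent
    (∀ x y : α, G.HasLoop x → G.HasLoop y → ¬ G.Neighbor x y) ∧
    -- at least five loops
    5 ≤ {e : β | ∃ x, G.IsLoopAt e x}.ncard ∧
    -- no complete bipartite graph on 3 + 3 vertices with a loop at each vertex of one side
    (¬ ∃ u v : Fin 3 → α, Function.Injective u ∧ Function.Injective v ∧
      (∀ i, G.HasLoop (u i)) ∧ ∀ i j, G.Neighbor (u i) (v j)) ∧
    -- no vertex is adjacent to more than three vertices with loops
    (∀ x : α, {y : α | G.Neighbor x y ∧ G.HasLoop y}.ncard ≤ 3) ∧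
    -- no subgraph with four vertices has eight or more edges
    (∀ H : Graph α β, H ≤ G → V(H).ncard = 4 → E(H).ncard < 8) := by
  classical
  obtain ⟨a, hP⟩ := exists_presents G
  have := hG.finite.vertexSet_finite.fintype
  have := hG.finite.edgeSet_finite.fintype
  have hM : IsMinimal a := hP.isMinimal hG
  have hmem : ∀ {x y}, 1 ≤ G.multiplicity x y → x ∈ V(G) ∧ y ∈ V(G) := by
    intro x y h
    obtain ⟨e, he⟩ := Set.nonempty_of_ncard_ne_zero (Nat.one_le_iff_ne_zero.1 h)
    exact ⟨Graph.IsLink.left_mem he, Graph.IsLink.right_mem he⟩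
  have hmult : ∀ x y : V(G), G.multiplicity x y = mult a x y := hP.multiplicity_eq
  have hloop : ∀ {x : α}, G.HasLoop x → ∃ h : x ∈ V(G), 1 ≤ mult a ⟨x, h⟩ ⟨x, h⟩ :=
    fun {x} ⟨e, he⟩ => ⟨he.vertex_mem, hP.hasLoop_iff (x := ⟨x, he.vertex_mem⟩).1 ⟨e, he⟩⟩
  have hadj : ∀ {x y : V(G)}, G.Adj x y → 1 ≤ mult a x y := fun h => hP.adj_iff.1 h
  -- the vertices and edges of a subgraph, counted in the types of vertices and edges of `G`
  have hsubV : ∀ H ≤ G, (Finset.univ.filter fun x : V(G) => (x : α) ∈ V(H)).card = V(H).ncard := by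
    intro H hH
    rw [← Set.ncard_coe_finset, ← Set.ncard_image_of_injective _ Subtype.val_injective]
    congr 1
    ext x
    simpa using fun hx => hH.vertexSet_mono hx
  have hsubE : ∀ H ≤ G, (Finset.univ.filter fun e : E(G) => (e : β) ∈ E(H)).card = E(H).ncard :=
    fun H hH => (hP.ncard_edges (p := (· ∈ E(H))) fun e he => hH.edgeSet_mono he).symm
  have hdouble : ∀ {x y : V(G)}, G.DoubleEdge x y → 2 ≤ mult a x y := fun h => hmult _ _ ▸ h.2
  refine ⟨?_, ?_, ?_, ?_, ?_, ?_, ?_, ?_, ?_⟩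
  · intro H hH h2 hreg
    refine hM.not_four_regular (Finset.univ.filter fun x : V(G) => (x : α) ∈ V(H))
      (Finset.univ.filter fun e : E(G) => (e : β) ∈ E(H)) (by rwa [hsubV H hH]) ?_ ?_
    · rintro ⟨e, t⟩ he
      have he : (e : β) ∈ E(H) := by simpa using he
      have hl := (hH.isLink_iff he).2 (hP.isLink e)
      cases t
      · simpa using hl.left_mem
      · simpa using hl.right_mem
    · intro x hx
      have hx : (x : α) ∈ V(H) := by simpa using hx
      have h4 := hreg x hx
      have hdeg : H.degree x = G.degreeIn E(H) x := by
        have h1 : {e | e ∈ E(H) ∧ H.Inc e x} = {e | e ∈ E(H) ∧ G.Inc e x} :=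
          Set.ext fun e => and_congr_right fun he => hH.inc_congr he
        have h2 : {e | e ∈ E(H) ∧ H.IsLoopAt e x} = {e | e ∈ E(H) ∧ G.IsLoopAt e x} :=
          Set.ext fun e => and_congr_right fun he => hH.isLoopAt_congr he
        rw [Graph.degree, Graph.degreeIn, Graph.degreeIn, h1, h2]
      rw [hdeg, hP.degreeIn_eq] at h4
      simpa using h4
  · intro x y
    by_contra! h
    obtain ⟨hx, hy⟩ := hmem (by omega : 1 ≤ G.multiplicity x y)
    rw [hmult ⟨x, hx⟩ ⟨y, hy⟩] at h
    by_cases hxy : x = y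
    · subst hxy
      have := two_mul_mult_self_le (a := a) ⟨x, hx⟩
      rw [hM.deg_eq] at this
      omega
    · have := hM.mult_lt_three (x := ⟨x, hx⟩) (y := ⟨y, hy⟩) (by simpa using hxy)
      omega
  · rintro ⟨p, hp, h01, h12, h23⟩
    have hV : ∀ i, p i ∈ V(G) := by
      have h0 := hmem (one_le_two.trans h01.2)
      have h2 := hmem (one_le_two.trans h23.2)
      intro i
      fin_cases i
      exacts [h0.1, h0.2, h2.1, h2.2]
    have hne : ∀ i j, i ≠ j → (⟨p i, hV i⟩ : V(G)) ≠ ⟨p j, hV j⟩ := fun i j hij h =>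
      hij (hp (congrArg Subtype.val h))
    exact hM.not_double_path (p₀ := ⟨p 0, hV 0⟩) (p₁ := ⟨p 1, hV 1⟩) (p₂ := ⟨p 2, hV 2⟩)
      (p₃ := ⟨p 3, hV 3⟩) (hne _ _ (by decide)) (hne _ _ (by decide)) (hne _ _ (by decide))
      (hne _ _ (by decide)) (hne _ _ (by decide)) (hne _ _ (by decide))
      (mult_comm a _ _ ▸ hdouble h01) (hdouble h12) (hdouble h23)
  · intro x y hx hxy
    obtain ⟨hxV, hx⟩ := hloop hx
    have hyV := (hmem (one_le_two.trans hxy.2)).2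
    have := hM.mult_lt_two_of_loop (x := ⟨x, hxV⟩) (y := ⟨y, hyV⟩) (by simpa using hxy.1) hx
    have := hdouble (x := ⟨x, hxV⟩) (y := ⟨y, hyV⟩) hxy
    omega
  · intro x y hx hy hxy
    obtain ⟨hxV, hx⟩ := hloop hx
    obtain ⟨hyV, hy⟩ := hloop hy
    have := hM.mult_eq_zero_of_loops (x := ⟨x, hxV⟩) (y := ⟨y, hyV⟩) (by simpa using hxy.1) hx hy
    have := hadj (x := ⟨x, hxV⟩) (y := ⟨y, hyV⟩) hxy.2
    omega
  · have h5 := hM.five_le_card_loops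
    have hl : ∀ e : E(G), (∃ x, G.IsLoopAt (e : β) x) ↔ a (e, true) = a (e, false) := by
      intro e
      constructor
      · rintro ⟨x, hx⟩
        obtain ⟨h1, h2⟩ := (hP.isLoopAt_iff (x := ⟨x, hx.vertex_mem⟩)).1 hx
        exact h2.trans h1.symm
      · exact fun h => ⟨a (e, false), hP.isLoopAt_iff.2 ⟨rfl, h⟩⟩
    rw [hP.ncard_edges fun e ⟨x, hx⟩ => hx.edge_mem]
    simpa [loops, hl] using h5
  · rintro ⟨u, v, hu, hv, hul, huv⟩
    choose huV hul using fun i => hloop (hul i)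
    have hvV : ∀ j, v j ∈ V(G) := fun j => (huv 0 j).2.right_mem
    exact hM.not_looped_bipartite (fun i => ⟨u i, huV i⟩) (fun j => ⟨v j, hvV j⟩)
      (fun i j h => hu (congrArg Subtype.val h)) (fun i j h => hv (congrArg Subtype.val h))
      (fun i j h => (huv i j).1 (congrArg Subtype.val h)) hul (fun i j => hadj (huv i j).2)
  · intro x
    by_contra! h
    obtain ⟨s, hs, hs4⟩ := Set.exists_subset_card_eq (Nat.succ_le_of_lt h)
    have : Finite s := Set.finite_of_ncard_ne_zero (by omega)
    obtain ⟨w⟩ : Nonempty (Fin 4 ≃ s) := ⟨(Finite.equivFinOfCardEq hs4).symm⟩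
    have hxV : x ∈ V(G) := (hs (w 0).2).1.2.left_mem
    choose hwV hwl using fun i => hloop (hs (w i).2).2
    refine hM.not_four_loop_neighbors ⟨x, hxV⟩ (fun i => ⟨w i, hwV i⟩) ?_ ?_ hwl ?_
    · exact fun i j h => w.injective (Subtype.ext (Subtype.mk.inj h))
    · exact fun i h => (hs (w i).2).1.1 (congrArg Subtype.val h).symm
    · exact fun i => hadj (hs (w i).2).1.2
  · intro H hH h4
    by_contra! h8
    rw [← hsubE H hH] at h8
    obtain ⟨F, hF, hF8⟩ := Finset.exists_subset_card_eq h8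
    rw [← hsubV H hH] at h4
    let w := (Finset.equivFinOfCardEq h4).symm
    refine hM.not_eight_edges (w := fun i => (w i : V(G)))
      (Subtype.val_injective.comp w.injective) F hF8 fun e he t => ?_
    have he : (e : β) ∈ E(H) := by simpa using hF he
    have hl := (hH.isLink_iff he).2 (hP.isLink e)
    have hV : (a (e, t) : α) ∈ V(H) := by
      cases t
      exacts [hl.left_mem, hl.right_mem]
    exact ⟨w.symm ⟨a (e, t), by simpa using hV⟩, by simp⟩
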